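/- There is an absolute constant $C>0$ with the following property. Let $1\le p<\infty$, let $n\ge 1$, and let $X$ be an $n$-dimensional subspace of a real space $L_p(\Omega,\mathcal E,\nu)$, where $(\Omega,\mathcal E,\nu)$ is an arbitrary measure space, with unit ball $B_X$. A position of $B_X$ is a set $\tilde B=T(B_X)\subset\mathbb R^n$, where $T:X\to\mathbb R^n$ is a linear isomorphism; $\|\cdot\|_{\tilde B}$ is the norm on $\mathbb R^n$ with unit ball $\tilde B$. Call $\tilde B$ a Lewis position of $B_X$ if, moreover, there is a finite even Borel measure $\mu$ on the Euclidean sphere $S^{n-1}$ which is isotropic, i.e. $\|x\|_2^2=\int_{S^{n-1}}|\langle x,\theta\rangle|^2\,d\mu(\theta)$ for all $x\in\mathbb R^n$, such that $$\|x\|_{\tilde B}=\Big(\int_{S^{n-1}}|\langle x,\theta\rangle|^p\,d\mu(\theta)\Big)^{1/p}\qquad\text{for all }x\in\mathbb R^n .$$ Then $B_X$ has a Lewis position, and every Lewis position $\tilde B$ of $B_X$ satisfies $$\mathbb E\|g\|_{\tilde B}^2<\infty\quad\text{and}\quad \operatorname{Var}\|g\|_{\tilde B}\le C^p\,n^{\frac2p-1},$$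 where $g$ is a standard Gaussian random vector in $\mathbb R^n$. -/

import Mathlib

open MeasureTheory ProbabilityTheory

/-- The Euclidean unit sphere `S^{n-1}` of `ℝⁿ`. -/
abbrev USphere (n : ℕ) : Type :=
  Metric.sphere (0 : EuclideanSpace ℝ (Fin n)) 1

/-- Isotropic Borel measures on the sphere: finite, even, and such that
`‖x‖₂² = ∫ |⟨x, θ⟩|² dμ(θ)` for every `x ∈ ℝⁿ`. -/
structure IsIsotropicMeasure {n : ℕ} (μ : Measure (USphere n)) : Prop where
  finite : IsFiniteMeasure μ
  even : μ.map (fun θ : USphere n => -θ) = μ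
  isotropic : ∀ x : EuclideanSpace ℝ (Fin n),
    ‖x‖ ^ 2 = ∫ θ : USphere n, |inner ℝ x (θ : EuclideanSpace ℝ (Fin n))| ^ 2 ∂μ

/-- `‖x‖_{B_p(μ)} = (∫ |⟨x, θ⟩|^p dμ(θ))^{1/p}`. -/
noncomputable def sphereLpNorm {n : ℕ} (p : ℝ) (μ : Measure (USphere n))
    (x : EuclideanSpace ℝ (Fin n)) : ℝ :=
  (∫ θ : USphere n, |inner ℝ x (θ : EuclideanSpace ℝ (Fin n))| ^ p ∂μ) ^ (1 / p)

/-- `B` is a position of the unit ball of the normed space `X`: the image of the closed unit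
ball under a linear isomorphism of `X` onto `ℝⁿ`. -/
def IsPosition {n : ℕ} (X : Type*) [NormedAddCommGroup X] [NormedSpace ℝ X]
    (B : Set (EuclideanSpace ℝ (Fin n))) : Prop :=
  ∃ T : X ≃ₗ[ℝ] EuclideanSpace ℝ (Fin n), B = T '' Metric.closedBall (0 : X) 1

/-- `B` is a position of the unit ball of `X` which is Lewis' position with exponent `p`:
the norm `gauge B` whose unit ball is `B` is `‖·‖_{B_p(μ)}` for some isotropic `μ`. -/
def IsLewisPosition {n : ℕ} (p : ℝ) (X : Type*) [NormedAddCommGroup X] [NormedSpace ℝ X]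
    (B : Set (EuclideanSpace ℝ (Fin n))) : Prop :=
  IsPosition X B ∧ ∃ μ : Measure (USphere n), IsIsotropicMeasure μ ∧
    ∀ x : EuclideanSpace ℝ (Fin n), gauge B x = sphereLpNorm p μ x

/-! Variance. Let `L x = ∫ |⟨x,θ⟩|^p dμ`, the `p`-th power of the norm, and let `M` be the `p`-th
absolute moment of a standard Gaussian. Taking the trace in the isotropy identity gives `μ` mass
`n`, so `E L(g) = nM`. By Fubini, `E L(g)²` is the integral over `μ × μ` of `E |⟨g,θ⟩|^p |⟨g,φ⟩|^p`.
Since `|·|^p` is even, its correlation for a Gaussian pair has no term linear in `ρ = ⟨θ,φ⟩`, and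
the expectation is at most `M² (1 + 16·4^p ρ²)` (`integral_abs_inner_rpow_mul_le`). Isotropy gives
`∫∫ ⟨θ,φ⟩² = n` rather than the trivial `n²`, so `Var L(g) ≤ 16·4^p n M²`. Comparing `L^{1/p}` with
`b = (nM)^{1/p}` costs a factor `b^{2-2p}`, leaving `16·4^p n^{2/p-1} M^{2/p}`, and `M^{2/p} ≤ 8^p`.

Existence is Lewis' extremal argument. A basis of `X` is a vector-valued function `V`. Among
operators `A` with `∫ ‖A V‖^p ≤ 1`, one maximizes `|det A|`. Testing the maximizer against rank-one
perturbations shows that the directions of `A V`, weighted by `‖A V‖^p`, are isotropic up to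
scaling. The symmetrized law of these directions is `μ`, and the same weight reproduces the norm of
`X`. -/

/-! ### Absolute moments of a Gaussian variable. -/

theorem integral_abs_rpow_mul_exp_neg_mul_sq {q b : ℝ} (hq : -1 < q) (hb : 0 < b) :
    ∫ x : ℝ, |x| ^ q * Real.exp (-b * x ^ 2) = b ^ (-(q + 1) / 2) * Real.Gamma ((q + 1) / 2) := by
  have h := integral_comp_abs (f := fun x : ℝ => x ^ q * Real.exp (-b * x ^ (2 : ℝ)))
  simp only [Real.rpow_two, sq_abs] at h
  rw [h]
  have h2 := integral_rpow_mul_exp_neg_mul_rpow (p := 2) (q := q) (b := b) (by norm_num) hq hb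
  simp only [Real.rpow_two] at h2
  rw [h2]; ring

theorem integral_abs_rpow_mul_exp_neg_mul_sq_pos {q b : ℝ} (hq : -1 < q) (hb : 0 < b) :
    0 < ∫ x : ℝ, |x| ^ q * Real.exp (-b * x ^ 2) := by
  rw [integral_abs_rpow_mul_exp_neg_mul_sq hq hb]
  have := Real.Gamma_pos_of_pos (s := (q + 1) / 2) (by linarith)
  positivity

/-- A nonintegrable function has integral `0` by convention, so the positive value already computed
forces integrability. -/
theorem integrable_abs_rpow_mul_exp_neg_mul_sq {q b : ℝ} (hq : -1 < q) (hb : 0 < b) :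
    Integrable (fun x : ℝ => |x| ^ q * Real.exp (-b * x ^ 2)) :=
  Integrable.of_integral_ne_zero (integral_abs_rpow_mul_exp_neg_mul_sq_pos hq hb).ne'

theorem gaussianPDFReal_zero_one (x : ℝ) :
    gaussianPDFReal 0 1 x = (√(2 * Real.pi))⁻¹ * Real.exp (-(1 / 2) * x ^ 2) := by
  simp only [gaussianPDFReal, NNReal.coe_one, mul_one, sub_zero]
  congr 2; ring

theorem integral_stdGaussianReal (f : ℝ → ℝ) :
    ∫ x, f x ∂gaussianReal 0 1 =
      (√(2 * Real.pi))⁻¹ * ∫ x, f x * Real.exp (-(1 / 2) * x ^ 2) := by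
  rw [integral_gaussianReal_eq_integral_smul one_ne_zero, ← integral_const_mul]
  refine integral_congr_ae (.of_forall fun x => ?_)
  simp only [gaussianPDFReal_zero_one, smul_eq_mul]; ring

/-- The absolute moment of order `p` of a standard Gaussian variable. -/
noncomputable def gaussianAbsMoment (p : ℝ) : ℝ := ∫ x, |x| ^ p ∂gaussianReal 0 1

theorem gaussianAbsMoment_eq_integral (p : ℝ) : gaussianAbsMoment p =
    (√(2 * Real.pi))⁻¹ * ∫ x, |x| ^ p * Real.exp (-(1 / 2) * x ^ 2) :=
  integral_stdGaussianReal _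

theorem gaussianAbsMoment_pos {p : ℝ} (hp : 0 ≤ p) : 0 < gaussianAbsMoment p := by
  rw [gaussianAbsMoment_eq_integral]
  have := integral_abs_rpow_mul_exp_neg_mul_sq_pos (q := p) (b := 1 / 2) (by linarith) (by norm_num)
  positivity

theorem gaussianAbsMoment_eq_Gamma {p : ℝ} (hp : 0 ≤ p) : gaussianAbsMoment p =
    2 ^ (p / 2) * Real.Gamma ((p + 1) / 2) / √Real.pi := by
  rw [gaussianAbsMoment_eq_integral,
    integral_abs_rpow_mul_exp_neg_mul_sq (by linarith) (by norm_num), one_div,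
    Real.inv_rpow (by norm_num), ← Real.rpow_neg (by norm_num), Real.sqrt_mul (by norm_num),
    show -(-(p + 1) / 2) = p / 2 + 1 / 2 by ring, Real.rpow_add (by norm_num), ← Real.sqrt_eq_rpow]
  have : √2 ≠ 0 := by positivity
  have : √Real.pi ≠ 0 := by positivity
  field_simp

/-- Log-convexity of `Γ` at the midpoint of `x` and `x + 1`. -/
theorem Real.Gamma_add_half_le {x : ℝ} (hx : 0 < x) :
    Real.Gamma (x + 1 / 2) ≤ √x * Real.Gamma x := by
  have h := Real.Gamma_mul_add_mul_le_rpow_Gamma_mul_rpow_Gamma (s := x) (t := x + 1)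
    (a := 1 / 2) (b := 1 / 2) hx (by linarith) (by norm_num) (by norm_num) (by norm_num)
  have hG := Real.Gamma_pos_of_pos hx
  rw [show 1 / 2 * x + 1 / 2 * (x + 1) = x + 1 / 2 by ring, Real.Gamma_add_one hx.ne',
    Real.mul_rpow hx.le hG.le, ← Real.sqrt_eq_rpow, ← Real.sqrt_eq_rpow] at h
  calc _ ≤ _ := h
    _ = √x * (√(Real.Gamma x) * √(Real.Gamma x)) := by ring
    _ = _ := by rw [Real.mul_self_sqrt hG.le]

/-- With `a = (p + 1) / 2`, the duplication formula splits `Γ(p+1)` into `Γ(a) Γ(a+1/2)`. One factor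
`2^p` comes from that formula, the other from `√a ≤ 2^p`. -/
theorem gaussianAbsMoment_two_mul_le {p : ℝ} (hp : 1 ≤ p) :
    gaussianAbsMoment (2 * p) ≤ 4 ^ p * gaussianAbsMoment p ^ 2 := by
  have hp0 : 0 < p := by linarith
  rw [gaussianAbsMoment_eq_Gamma (by linarith), gaussianAbsMoment_eq_Gamma hp0.le]
  set a := (p + 1) / 2 with ha
  have ha0 : 0 < a := by positivity
  have hGa := Real.Gamma_pos_of_pos ha0
  have hGp := Real.Gamma_pos_of_pos hp0
  have hpi : 0 < √Real.pi := by positivity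
  have h1 := Real.Gamma_add_half_le ha0
  have h2 := Real.Gamma_mul_Gamma_add_half a
  rw [show 2 * a = p + 1 by rw [ha]; ring, Real.Gamma_add_one hp0.ne',
    show 1 - (p + 1) = -p by ring, Real.rpow_neg (by norm_num)] at h2
  have h3 := Real.Gamma_add_half_le hp0
  rw [show (2 * p + 1) / 2 = p + 1 / 2 by ring, show 2 * p / 2 = p by ring]
  have h2p : (0 : ℝ) < 2 ^ p := by positivity
  have h4 : √p ≤ p := by
    rw [Real.sqrt_le_left hp0.le]; nlinarith
  have hsa : √a ≤ 2 ^ p := by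
    have : 1 + p * 1 ≤ (1 + 1 : ℝ) ^ p := one_add_mul_self_le_rpow_one_add (by norm_num) hp
    norm_num at this
    rw [Real.sqrt_le_left h2p.le]
    nlinarith
  -- `Γ(p+1) √π = 2^p Γ(a) Γ(a+1/2)`
  have h5 : p * Real.Gamma p * √Real.pi = 2 ^ p * (Real.Gamma a * Real.Gamma (a + 1 / 2)) := by
    rw [h2]; field_simp
  have h6 : Real.Gamma (p + 1 / 2) * √Real.pi ≤ 4 ^ p * Real.Gamma a ^ 2 := by
    calc Real.Gamma (p + 1 / 2) * √Real.pi ≤ p * Real.Gamma p * √Real.pi := by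
          gcongr; exact h3.trans (by gcongr)
      _ = 2 ^ p * (Real.Gamma a * Real.Gamma (a + 1 / 2)) := h5
      _ ≤ 2 ^ p * (Real.Gamma a * (2 ^ p * Real.Gamma a)) := by
          gcongr; exact h1.trans (by gcongr)
      _ = (2 ^ p * 2 ^ p) * Real.Gamma a ^ 2 := by ring
      _ = _ := by rw [← Real.mul_rpow (by norm_num) (by norm_num)]; norm_num
  have h7 : ((2 : ℝ) ^ (p / 2)) ^ 2 = 2 ^ p := by
    rw [← Real.rpow_mul_natCast (by norm_num)]; congr 1; push_cast; ring
  rw [div_pow, mul_pow, h7, div_le_iff₀ hpi]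
  calc (2 : ℝ) ^ p * Real.Gamma (p + 1 / 2)
      = 2 ^ p * (Real.Gamma (p + 1 / 2) * √Real.pi) / √Real.pi := by field_simp
    _ ≤ 2 ^ p * (4 ^ p * Real.Gamma a ^ 2) / √Real.pi := by gcongr
    _ = _ := by field_simp

theorem gaussianAbsMoment_rpow_two_div_le {p : ℝ} (hp : 1 ≤ p) :
    gaussianAbsMoment p ^ (2 / p) ≤ 8 ^ p := by
  have hp0 : 0 < p := by linarith
  -- This is `y ≤ e^y` at `y = x² / (2p)`, raised to the power `p / 2`; the scale is chosen so that
  -- half of the Gaussian weight survives.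
  have key : ∀ x : ℝ, |x| ^ p ≤ (2 * p) ^ (p / 2) * Real.exp ((1 / 4) * x ^ 2) := by
    intro x
    have h1 : x ^ 2 ≤ (2 * p) * Real.exp (x ^ 2 / (2 * p)) := by
      have := Real.add_one_le_exp (x ^ 2 / (2 * p))
      calc x ^ 2 = (2 * p) * (x ^ 2 / (2 * p)) := by field_simp
        _ ≤ _ := by gcongr; linarith
    calc |x| ^ p = (x ^ 2) ^ (p / 2) := by
          rw [← sq_abs, ← Real.rpow_natCast, ← Real.rpow_mul (abs_nonneg x)]; congr 1
          push_cast; ring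
      _ ≤ ((2 * p) * Real.exp (x ^ 2 / (2 * p))) ^ (p / 2) := by gcongr
      _ = _ := by
          rw [Real.mul_rpow (by positivity) (by positivity), ← Real.exp_mul]
          congr 2; field_simp; norm_num
  have hM : gaussianAbsMoment p ≤ (2 * p) ^ (p / 2) * √2 := by
    rw [gaussianAbsMoment_eq_integral]
    have h1 : ∫ x : ℝ, |x| ^ p * Real.exp (-(1 / 2) * x ^ 2) ≤
        ∫ x : ℝ, (2 * p) ^ (p / 2) * Real.exp (-(1 / 4) * x ^ 2) := by
      refine integral_mono (integrable_abs_rpow_mul_exp_neg_mul_sq (by linarith) (by norm_num))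
        ((integrable_exp_neg_mul_sq (by norm_num)).const_mul _) fun x => ?_
      calc |x| ^ p * Real.exp (-(1 / 2) * x ^ 2) ≤
          (2 * p) ^ (p / 2) * Real.exp ((1 / 4) * x ^ 2) * Real.exp (-(1 / 2) * x ^ 2) := by
            gcongr; exact key x
        _ = _ := by
            rw [mul_assoc, ← Real.exp_add]; congr 2; ring
    rw [integral_const_mul, integral_gaussian] at h1
    calc _ ≤ (√(2 * Real.pi))⁻¹ * ((2 * p) ^ (p / 2) * √(Real.pi / (1 / 4))) := by gcongr
      _ = _ := by
        rw [show Real.pi / (1 / 4) = (2 * Real.pi) * 2 by ring, Real.sqrt_mul (x := 2 * Real.pi) (by positivity) 2,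
          mul_left_comm, inv_mul_cancel_left₀ (by positivity)]
  have h2 : gaussianAbsMoment p ^ (2 / p) ≤ ((2 * p) ^ (p / 2) * √2) ^ (2 / p) := by
    have := (gaussianAbsMoment_pos hp0.le).le
    gcongr
  refine h2.trans ?_
  rw [Real.mul_rpow (by positivity) (by positivity), ← Real.rpow_mul (by positivity),
    show p / 2 * (2 / p) = 1 by field_simp, Real.rpow_one, Real.sqrt_eq_rpow,
    ← Real.rpow_mul (by norm_num), show 1 / 2 * (2 / p) = 1 / p by field_simp]
  have h3 : (2 : ℝ) ^ (1 / p) ≤ 2 := by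
    calc (2 : ℝ) ^ (1 / p) ≤ 2 ^ (1 : ℝ) :=
          Real.rpow_le_rpow_of_exponent_le (by norm_num) (by rw [div_le_one hp0]; exact hp)
      _ = 2 := Real.rpow_one 2
  have h4 : 1 + p * 7 ≤ (1 + 7 : ℝ) ^ p := one_add_mul_self_le_rpow_one_add (by norm_num) hp
  norm_num at h4
  nlinarith

/-! ### Absolute moments of a correlated Gaussian pair. -/

/-- The linear terms cancel: `e^y + e^{-y} - 2 = (e^{y/2} - e^{-y/2})²`, and for `y ≥ 0` the
difference is at most `y e^{y/2}`. The constant 32 comes from `(|t|/4)² / 2 ≤ e^{|t|/4}`. -/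
theorem exp_add_exp_neg_le {ρ t : ℝ} (hρ : |ρ| ≤ 1 / 4) :
    Real.exp (ρ * t) + Real.exp (-(ρ * t)) ≤ 2 + 32 * ρ ^ 2 * Real.exp (|t| / 2) := by
  have h1 : ∀ y : ℝ, Real.exp y + Real.exp (-y) ≤ 2 + y ^ 2 * Real.exp |y| := by
    have main : ∀ y : ℝ, 0 ≤ y → Real.exp y + Real.exp (-y) ≤ 2 + y ^ 2 * Real.exp y := by
      intro y hy
      have e1 : Real.exp (-y) = Real.exp (-(y / 2)) ^ 2 := by
        rw [← Real.exp_nat_mul]; congr 1; push_cast; ring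
      have e2 : Real.exp y = Real.exp (y / 2) ^ 2 := by
        rw [← Real.exp_nat_mul]; congr 1; push_cast; ring
      have e3 : Real.exp (-(y / 2)) * Real.exp (y / 2) = 1 := by
        rw [← Real.exp_add]; simp
      have e4 : Real.exp (y / 2) - Real.exp (-(y / 2)) ≤ y * Real.exp (y / 2) := by
        have h := Real.add_one_le_exp (-y)
        have : Real.exp (-(y / 2)) = Real.exp (-y) * Real.exp (y / 2) := by
          rw [← Real.exp_add]; congr 1; ring
        rw [this]
        nlinarith [Real.exp_pos (y / 2)]
      have e5 : 0 ≤ Real.exp (y / 2) - Real.exp (-(y / 2)) := by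
        have := Real.exp_le_exp.2 (show -(y / 2) ≤ y / 2 by linarith)
        linarith
      have e6 := pow_le_pow_left₀ e5 e4 2
      rw [e1, e2]
      nlinarith
    intro y
    rcases le_total 0 y with hy | hy
    · rw [abs_of_nonneg hy]; exact main y hy
    · have := main (-y) (by linarith)
      rw [neg_neg] at this
      rw [abs_of_nonpos hy]; nlinarith
  refine (h1 _).trans ?_
  have h2 : |ρ * t| ≤ |t| / 4 := by
    rw [abs_mul]; nlinarith [abs_nonneg t]
  have h3 : t ^ 2 ≤ 32 * Real.exp (|t| / 4) := by
    have := Real.quadratic_le_exp_of_nonneg (x := |t| / 4) (by positivity)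
    nlinarith [abs_nonneg t, sq_abs t]
  have h4 : Real.exp (|t| / 2) = Real.exp (|t| / 4) * Real.exp (|t| / 4) := by
    rw [← Real.exp_add]; congr 1; ring
  have h5 : Real.exp |ρ * t| ≤ Real.exp (|t| / 4) := Real.exp_le_exp.2 h2
  rw [h4, mul_pow]
  calc 2 + ρ ^ 2 * t ^ 2 * Real.exp |ρ * t|
      ≤ 2 + ρ ^ 2 * (32 * Real.exp (|t| / 4)) * Real.exp (|t| / 4) := by gcongr
    _ = _ := by ring

/-- Averaging over `v` and `-v` removes the term linear in `ρ`. Then `|uv|/2 ≤ u²/4 + v²/4`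
decouples the variables at the price of half the Gaussian exponent. -/
theorem integral_abs_rpow_mul_exp_mul_le {p ρ : ℝ} (hp : 0 ≤ p) (hρ : |ρ| ≤ 1 / 4) (u : ℝ) :
    ∫ v : ℝ, |v| ^ p * Real.exp (-(1 / 2) * v ^ 2) * Real.exp (ρ * (u * v)) ≤
      (∫ v : ℝ, |v| ^ p * Real.exp (-(1 / 2) * v ^ 2)) +
        16 * ρ ^ 2 * Real.exp ((1 / 4) * u ^ 2) *
          ∫ v : ℝ, |v| ^ p * Real.exp (-(1 / 4) * v ^ 2) := by
  have i1 := integrable_abs_rpow_mul_exp_neg_mul_sq (q := p) (b := 1 / 2)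
    (by linarith) (by norm_num)
  have i2 := integrable_abs_rpow_mul_exp_neg_mul_sq (q := p) (b := 1 / 4)
    (by linarith) (by norm_num)
  set f : ℝ → ℝ := fun v => |v| ^ p * Real.exp (-(1 / 2) * v ^ 2) * Real.exp (ρ * (u * v)) with hf
  by_cases hi : Integrable f
  · have e1 : ∫ v, f (-v) = ∫ v, f v := integral_neg_eq_self f volume
    have e2 : ∫ v, (f v + f (-v)) = 2 * ∫ v, f v := by
      rw [integral_add hi hi.comp_neg, e1]; ring
    have e3 : ∫ v, (f v + f (-v)) ≤ ∫ v, (2 * (|v| ^ p * Real.exp (-(1 / 2) * v ^ 2)) +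
        32 * ρ ^ 2 * Real.exp ((1 / 4) * u ^ 2) * (|v| ^ p * Real.exp (-(1 / 4) * v ^ 2))) := by
      refine integral_mono (hi.add hi.comp_neg) ((i1.const_mul _).add (i2.const_mul _)) fun v => ?_
      have h1 := exp_add_exp_neg_le (t := u * v) hρ
      have h2 : Real.exp (|u * v| / 2) ≤ Real.exp ((1 / 4) * u ^ 2 + (1 / 4) * v ^ 2) := by
        refine Real.exp_le_exp.2 ?_
        rw [abs_mul]
        nlinarith [sq_nonneg (|u| - |v|), sq_abs u, sq_abs v]
      have h3 : Real.exp (-(1 / 4) * v ^ 2) =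
          Real.exp (-(1 / 2) * v ^ 2) * Real.exp ((1 / 4) * v ^ 2) := by
        rw [← Real.exp_add]; congr 1; ring
      have h4 : f v + f (-v) = |v| ^ p * Real.exp (-(1 / 2) * v ^ 2) *
          (Real.exp (ρ * (u * v)) + Real.exp (-(ρ * (u * v)))) := by
        simp only [hf, abs_neg, even_two.neg_pow, mul_neg]; ring
      simp only [h4]
      rw [Real.exp_add] at h2
      calc _ ≤ |v| ^ p * Real.exp (-(1 / 2) * v ^ 2) * (2 + 32 * ρ ^ 2 *
            (Real.exp ((1 / 4) * u ^ 2) * Real.exp ((1 / 4) * v ^ 2))) := by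
            exact mul_le_mul_of_nonneg_left (h1.trans (by gcongr)) (by positivity)
        _ = _ := by rw [h3]; ring
    rw [integral_add (i1.const_mul _) (i2.const_mul _), integral_const_mul, integral_const_mul,
      e2] at e3
    linarith
  -- Without integrability the left side is `0` by convention and the right side is nonnegative.
  · rw [integral_undef hi]
    have := integral_nonneg (μ := volume) (f := fun v : ℝ => |v| ^ p * Real.exp (-(1 / 2) * v ^ 2))
      fun v => by positivity
    have := integral_nonneg (μ := volume) (f := fun v : ℝ => |v| ^ p * Real.exp (-(1 / 4) * v ^ 2))
      fun v => by positivity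
    positivity

/-- Substitute `x = s u` and `w = v - ρ u`: then `ρ x + s w = s v`, and `s² + ρ² = 1` turns the
exponent into `-(u² + v²)/2 + ρ u v`. The factor `s` beyond `s^{2p}` is the Jacobian. -/
theorem integral_integral_abs_rpow_correlated_eq {p ρ s : ℝ} (hs : 0 < s)
    (hρs : s ^ 2 + ρ ^ 2 = 1) :
    ∫ x : ℝ, ∫ w : ℝ, |x| ^ p * |ρ * x + s * w| ^ p ∂gaussianReal 0 1 ∂gaussianReal 0 1 =
      s ^ (2 * p + 1) * ((2 * Real.pi)⁻¹ * ∫ u : ℝ, |u| ^ p * Real.exp (-(1 / 2) * u ^ 2) *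
        ∫ v : ℝ, |v| ^ p * Real.exp (-(1 / 2) * v ^ 2) * Real.exp (ρ * (u * v))) := by
  simp only [integral_stdGaussianReal]
  set c := (√(2 * Real.pi))⁻¹ with hc
  have hcc : c * c = (2 * Real.pi)⁻¹ := by
    rw [hc, ← mul_inv, Real.mul_self_sqrt (by positivity)]
  set g : ℝ → ℝ := fun x => (c * ∫ w : ℝ, |x| ^ p * |ρ * x + s * w| ^ p *
    Real.exp (-(1 / 2) * w ^ 2)) * Real.exp (-(1 / 2) * x ^ 2) with hg
  have h1 : ∫ x, g x = s * ∫ u, g (s * u) := by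
    rw [Measure.integral_comp_mul_left, abs_of_pos (inv_pos.2 hs), smul_eq_mul,
      mul_inv_cancel_left₀ hs.ne']
  have h2 : ∀ u, g (s * u) = c * s ^ (2 * p) * (|u| ^ p * Real.exp (-(1 / 2) * u ^ 2) *
      ∫ v : ℝ, |v| ^ p * Real.exp (-(1 / 2) * v ^ 2) * Real.exp (ρ * (u * v))) := by
    intro u
    have h3 := integral_sub_right_eq_self (μ := volume) (fun w : ℝ => |s * u| ^ p *
      |ρ * (s * u) + s * w| ^ p * Real.exp (-(1 / 2) * w ^ 2)) (ρ * u)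
    simp only [hg]
    rw [← h3, mul_assoc, mul_comm _ (Real.exp _), ← integral_const_mul, ← integral_const_mul,
      ← integral_const_mul, ← integral_const_mul]
    refine integral_congr_ae (.of_forall fun v => ?_)
    have e1 : ρ * (s * u) + s * (v - ρ * u) = s * v := by ring
    simp only [e1, abs_mul, abs_of_pos hs]
    rw [Real.mul_rpow hs.le (abs_nonneg _), Real.mul_rpow hs.le (abs_nonneg _),
      two_mul, Real.rpow_add hs]
    have e2 : Real.exp (-(1 / 2) * (s * u) ^ 2) * Real.exp (-(1 / 2) * (v - ρ * u) ^ 2) =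
        Real.exp (-(1 / 2) * u ^ 2) *
          (Real.exp (-(1 / 2) * v ^ 2) * Real.exp (ρ * (u * v))) := by
      rw [← Real.exp_add, ← Real.exp_add, ← Real.exp_add]; congr 1
      rw [mul_pow, show s ^ 2 = 1 - ρ ^ 2 by linarith]; ring
    linear_combination (c * s ^ p * s ^ p * |u| ^ p * |v| ^ p) * e2
  rw [h1]
  simp only [h2]
  rw [integral_const_mul, ← hcc, Real.rpow_add hs, Real.rpow_one]
  ring

theorem integral_integral_abs_rpow_correlated_le {p ρ s : ℝ} (hp : 1 ≤ p) (hs : 0 < s)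
    (hρs : s ^ 2 + ρ ^ 2 = 1) (hρ : |ρ| ≤ 1 / 4) :
    ∫ x : ℝ, ∫ w : ℝ, |x| ^ p * |ρ * x + s * w| ^ p ∂gaussianReal 0 1 ∂gaussianReal 0 1 ≤
      gaussianAbsMoment p ^ 2 * (1 + 16 * 4 ^ p * ρ ^ 2) := by
  have hp0 : 0 ≤ p := by linarith
  rw [integral_integral_abs_rpow_correlated_eq hs hρs]
  have i1 := integrable_abs_rpow_mul_exp_neg_mul_sq (q := p) (b := 1 / 2)
    (by linarith) (by norm_num)
  have i2 := integrable_abs_rpow_mul_exp_neg_mul_sq (q := p) (b := 1 / 4)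
    (by linarith) (by norm_num)
  set A := ∫ v : ℝ, |v| ^ p * Real.exp (-(1 / 2) * v ^ 2) with hA
  set B := ∫ v : ℝ, |v| ^ p * Real.exp (-(1 / 4) * v ^ 2) with hB
  have hA0 : 0 ≤ A := integral_nonneg fun v => by positivity
  have hB0 : 0 ≤ B := integral_nonneg fun v => by positivity
  -- Halving the exponent multiplies the integral by `2^{(p+1)/2}`; the square of this factor is at
  -- most `4^p` because `p ≥ 1`.
  have hBA : B ^ 2 = 2 ^ (p + 1) * A ^ 2 := by
    have e : ((1 : ℝ) / 4) ^ (-(p + 1) / 2) = 2 ^ ((p + 1) / 2) * (1 / 2) ^ (-(p + 1) / 2) := by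
      rw [one_div, one_div, Real.inv_rpow (by norm_num), Real.inv_rpow (by norm_num),
        ← Real.rpow_neg (by norm_num), ← Real.rpow_neg (by norm_num), neg_div, neg_neg,
        ← Real.mul_rpow (by norm_num) (by norm_num)]
      norm_num
    have e2 : ((2 : ℝ) ^ ((p + 1) / 2)) ^ 2 = 2 ^ (p + 1) := by
      rw [← Real.rpow_mul_natCast (by norm_num)]; congr 1; push_cast; ring
    rw [hB, hA, integral_abs_rpow_mul_exp_neg_mul_sq (by linarith) (by norm_num),
      integral_abs_rpow_mul_exp_neg_mul_sq (by linarith) (by norm_num), e, ← e2]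
    ring
  have hI : ∫ u : ℝ, |u| ^ p * Real.exp (-(1 / 2) * u ^ 2) *
        ∫ v : ℝ, |v| ^ p * Real.exp (-(1 / 2) * v ^ 2) * Real.exp (ρ * (u * v)) ≤
      A ^ 2 + 16 * ρ ^ 2 * B ^ 2 := by
    calc _ ≤ ∫ u : ℝ, (A * (|u| ^ p * Real.exp (-(1 / 2) * u ^ 2)) +
          16 * ρ ^ 2 * B * (|u| ^ p * Real.exp (-(1 / 4) * u ^ 2))) := by
          refine integral_mono_of_nonneg (.of_forall fun u => ?_)
            ((i1.const_mul _).add (i2.const_mul _)) (.of_forall fun u => ?_)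
          · exact mul_nonneg (by positivity) (integral_nonneg fun v => by positivity)
          · have h := integral_abs_rpow_mul_exp_mul_le hp0 hρ u
            have h3 : Real.exp (-(1 / 4) * u ^ 2) =
                Real.exp (-(1 / 2) * u ^ 2) * Real.exp ((1 / 4) * u ^ 2) := by
              rw [← Real.exp_add]; congr 1; ring
            simp only
            calc _ ≤ |u| ^ p * Real.exp (-(1 / 2) * u ^ 2) *
                (A + 16 * ρ ^ 2 * Real.exp ((1 / 4) * u ^ 2) * B) := by gcongr
              _ = _ := by rw [h3]; ring
      _ = A ^ 2 + 16 * ρ ^ 2 * B ^ 2 := by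
          rw [integral_add (i1.const_mul _) (i2.const_mul _), integral_const_mul,
            integral_const_mul]
          ring
  have hs1 : s ^ (2 * p + 1) ≤ 1 :=
    Real.rpow_le_one hs.le (by nlinarith [sq_nonneg ρ]) (by linarith)
  have h2p : (2 : ℝ) ^ (p + 1) ≤ 4 ^ p := by
    rw [show (4 : ℝ) = 2 ^ (2 : ℝ) by norm_num, ← Real.rpow_mul (by norm_num)]
    exact Real.rpow_le_rpow_of_exponent_le (by norm_num) (by linarith)
  have hM : gaussianAbsMoment p ^ 2 = (2 * Real.pi)⁻¹ * A ^ 2 := by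
    rw [gaussianAbsMoment_eq_integral, mul_pow, inv_pow, Real.sq_sqrt (by positivity)]
  rw [hBA] at hI
  have hI0 : 0 ≤ ∫ u : ℝ, |u| ^ p * Real.exp (-(1 / 2) * u ^ 2) *
        ∫ v : ℝ, |v| ^ p * Real.exp (-(1 / 2) * v ^ 2) * Real.exp (ρ * (u * v)) :=
    integral_nonneg fun u => mul_nonneg (by positivity) (integral_nonneg fun v => by positivity)
  calc _ ≤ 1 * ((2 * Real.pi)⁻¹ * (A ^ 2 + 16 * ρ ^ 2 * (4 ^ p * A ^ 2))) := by
        gcongr; exact hI.trans (by gcongr)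
    _ = _ := by rw [hM]; ring

/-! ### Projections of a Gaussian vector. -/

section StdGaussian

variable {E : Type*} [NormedAddCommGroup E] [InnerProductSpace ℝ E] [FiniteDimensional ℝ E]
  [MeasurableSpace E] [BorelSpace E]

theorem map_inner_stdGaussian {θ : E} (hθ : ‖θ‖ = 1) :
    (stdGaussian E).map (fun x => inner ℝ θ x) = gaussianReal 0 1 := by
  have h := IsGaussian.map_eq_gaussianReal (μ := stdGaussian E) (innerSL ℝ θ)
  rw [integral_strongDual_stdGaussian, variance_dual_stdGaussian, innerSL_apply_norm, hθ] at h
  simpa using h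

theorem indepFun_inner_stdGaussian {θ ψ : E} (h : inner ℝ θ ψ = 0) :
    IndepFun (fun x : E => inner ℝ θ x) (fun x => inner ℝ ψ x) (stdGaussian E) := by
  refine HasGaussianLaw.indepFun_of_covariance_eq_zero ?_ ?_
  · exact (IsGaussian.hasGaussianLaw_id (μ := stdGaussian E)).map_fun
      ((innerSL ℝ θ).prod (innerSL ℝ ψ))
  · rw [← covarianceBilin_apply_eq_cov IsGaussian.memLp_two_id, covarianceBilin_stdGaussian,
      innerSL_apply_apply, h]

theorem integrable_norm_rpow_stdGaussian {q : ℝ} (hq : 0 < q) :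
    Integrable (fun x : E => ‖x‖ ^ q) (stdGaussian E) := by
  have h := (IsGaussian.memLp_id (stdGaussian E) (ENNReal.ofReal q)
    ENNReal.ofReal_ne_top).integrable_norm_rpow (by simpa using hq) ENNReal.ofReal_ne_top
  simpa [ENNReal.toReal_ofReal hq.le] using h

theorem integral_abs_inner_rpow_stdGaussian {θ : E} (hθ : ‖θ‖ = 1) {p : ℝ} (hp : 0 ≤ p) :
    ∫ x : E, |inner ℝ θ x| ^ p ∂stdGaussian E = gaussianAbsMoment p := by
  rw [gaussianAbsMoment, ← map_inner_stdGaussian hθ, integral_map (by fun_prop)]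
  exact (continuous_abs.rpow_const fun _ => .inr hp).aestronglyMeasurable

theorem integrable_abs_inner_rpow_mul_stdGaussian {θ φ : E} (hθ : ‖θ‖ ≤ 1) (hφ : ‖φ‖ ≤ 1)
    {p : ℝ} (hp : 0 < p) :
    Integrable (fun x : E => |inner ℝ θ x| ^ p * |inner ℝ φ x| ^ p) (stdGaussian E) := by
  refine (integrable_norm_rpow_stdGaussian (E := E) (q := p + p) (by linarith)).mono' ?_
    (.of_forall fun x => ?_)
  · refine Continuous.aestronglyMeasurable ?_
    exact ((by fun_prop : Continuous fun x : E => |inner ℝ θ x|).rpow_const fun _ => .inr hp.le).mul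
      ((by fun_prop : Continuous fun x : E => |inner ℝ φ x|).rpow_const fun _ => .inr hp.le)
  · have h1 : |inner ℝ θ x| ≤ ‖x‖ :=
      (abs_real_inner_le_norm _ _).trans (mul_le_of_le_one_left (norm_nonneg _) hθ)
    have h2 : |inner ℝ φ x| ≤ ‖x‖ :=
      (abs_real_inner_le_norm _ _).trans (mul_le_of_le_one_left (norm_nonneg _) hφ)
    rw [Real.norm_of_nonneg (by positivity), Real.rpow_add_of_nonneg (norm_nonneg _) hp.le hp.le]
    gcongr

theorem integral_abs_inner_rpow_mul_le {θ φ : E} (hθ : ‖θ‖ = 1) (hφ : ‖φ‖ = 1) {p : ℝ}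
    (hp : 1 ≤ p) :
    ∫ x : E, |inner ℝ θ x| ^ p * |inner ℝ φ x| ^ p ∂stdGaussian E ≤
      gaussianAbsMoment p ^ 2 * (1 + 16 * 4 ^ p * inner ℝ θ φ ^ 2) := by
  have hp0 : 0 < p := by linarith
  set ρ : ℝ := inner ℝ θ φ with hρ
  rcases le_or_gt |ρ| (1 / 4) with hρ4 | hρ4
  -- Weak correlation: write `φ = ρ θ + s ψ` with `ψ` a unit vector orthogonal to `θ`, so that the
  -- two projections onto `θ` and `ψ` are independent standard Gaussians.
  · have hρ2 : ρ ^ 2 ≤ 1 / 16 := by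
      rw [← sq_abs]; nlinarith [abs_nonneg ρ]
    set s := √(1 - ρ ^ 2) with hs
    have hs0 : 0 < s := Real.sqrt_pos.2 (by linarith)
    have hs2 : s ^ 2 = 1 - ρ ^ 2 := Real.sq_sqrt (by linarith)
    set ψ : E := s⁻¹ • (φ - ρ • θ) with hψ
    have hφψ : φ = ρ • θ + s • ψ := by
      rw [hψ, smul_inv_smul₀ hs0.ne']; abel
    have hθθ : inner ℝ θ θ = (1 : ℝ) := by rw [real_inner_self_eq_norm_sq, hθ]; norm_num
    have hφφ : inner ℝ φ φ = (1 : ℝ) := by rw [real_inner_self_eq_norm_sq, hφ]; norm_num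
    have hort : inner ℝ θ ψ = (0 : ℝ) := by
      rw [hψ, inner_smul_right, inner_sub_right, inner_smul_right, hθθ, ← hρ]; ring
    have hψ1 : ‖ψ‖ = 1 := by
      have h1 : inner ℝ (φ - ρ • θ) (φ - ρ • θ) = s ^ 2 := by
        rw [inner_sub_left, inner_sub_right, inner_sub_right, inner_smul_left, inner_smul_left,
          inner_smul_right, inner_smul_right, hφφ, hθθ, real_inner_comm, ← hρ, hs2]
        simp; ring
      rw [real_inner_self_eq_norm_sq] at h1
      have h2 : ‖φ - ρ • θ‖ = s := (sq_eq_sq₀ (norm_nonneg _) hs0.le).1 h1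
      rw [hψ, norm_smul, h2, norm_inv, Real.norm_of_nonneg hs0.le, inv_mul_cancel₀ hs0.ne']
    have hmap : (stdGaussian E).map (fun x => ((inner ℝ θ x : ℝ), (inner ℝ ψ x : ℝ))) =
        (gaussianReal 0 1).prod (gaussianReal 0 1) := by
      rw [(indepFun_iff_map_prod_eq_prod_map_map (by fun_prop) (by fun_prop)).1
        (indepFun_inner_stdGaussian hort), map_inner_stdGaussian hθ, map_inner_stdGaussian hψ1]
    have hcont : Continuous fun z : ℝ × ℝ => |z.1| ^ p * |ρ * z.1 + s * z.2| ^ p :=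
      ((by fun_prop : Continuous fun z : ℝ × ℝ => |z.1|).rpow_const fun _ => .inr hp0.le).mul
        ((by fun_prop : Continuous fun z : ℝ × ℝ => |ρ * z.1 + s * z.2|).rpow_const
          fun _ => .inr hp0.le)
    have hφx : ∀ x : E, (inner ℝ φ x : ℝ) = ρ * inner ℝ θ x + s * inner ℝ ψ x := by
      intro x
      conv_lhs => rw [hφψ]
      rw [inner_add_left, inner_smul_left, inner_smul_left]; simp
    have hint := integrable_abs_inner_rpow_mul_stdGaussian hθ.le hφ.le hp0
    simp only [hφx] at hint ⊢
    have hm : AEMeasurable (fun x : E => ((inner ℝ θ x : ℝ), (inner ℝ ψ x : ℝ)))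
        (stdGaussian E) := by fun_prop
    have hint2 : Integrable (fun z : ℝ × ℝ => |z.1| ^ p * |ρ * z.1 + s * z.2| ^ p)
        ((gaussianReal 0 1).prod (gaussianReal 0 1)) := by
      rw [← hmap, integrable_map_measure hcont.aestronglyMeasurable hm]
      exact hint
    have heq : ∫ x : E, |inner ℝ θ x| ^ p * |ρ * inner ℝ θ x + s * inner ℝ ψ x| ^ p ∂stdGaussian E
        = ∫ z : ℝ × ℝ, |z.1| ^ p * |ρ * z.1 + s * z.2| ^ p
          ∂(gaussianReal 0 1).prod (gaussianReal 0 1) := by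
      rw [← hmap, integral_map hm hcont.aestronglyMeasurable]
    rw [heq, integral_prod _ hint2]
    exact integral_integral_abs_rpow_correlated_le hp hs0 (by linarith) hρ4
  -- Strong correlation: here `16 ρ² ≥ 1`, so the crude bound by the moment of order `2p` already
  -- suffices.
  · have hρ2 : 1 / 16 ≤ ρ ^ 2 := by
      rw [← sq_abs]; nlinarith
    have h1 : ∀ η : E, ‖η‖ = 1 →
        Integrable (fun x : E => |inner ℝ η x| ^ (2 * p)) (stdGaussian E) := by
      intro η hη
      refine (integrable_abs_inner_rpow_mul_stdGaussian hη.le hη.le hp0).congr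
        (.of_forall fun x => ?_)
      simp only [two_mul]
      rw [Real.rpow_add_of_nonneg (abs_nonneg _) hp0.le hp0.le]
    have h2 : ∫ x : E, |inner ℝ θ x| ^ p * |inner ℝ φ x| ^ p ∂stdGaussian E ≤
        ∫ x : E, (2⁻¹ * |inner ℝ θ x| ^ (2 * p) + 2⁻¹ * |inner ℝ φ x| ^ (2 * p))
          ∂stdGaussian E := by
      refine integral_mono (integrable_abs_inner_rpow_mul_stdGaussian hθ.le hφ.le hp0)
        (((h1 θ hθ).const_mul _).add ((h1 φ hφ).const_mul _)) fun x => ?_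
      simp only [two_mul]
      rw [Real.rpow_add_of_nonneg (abs_nonneg _) hp0.le hp0.le,
        Real.rpow_add_of_nonneg (abs_nonneg _) hp0.le hp0.le]
      nlinarith [sq_nonneg (|(inner ℝ θ x : ℝ)| ^ p - |(inner ℝ φ x : ℝ)| ^ p)]
    rw [integral_add ((h1 θ hθ).const_mul _) ((h1 φ hφ).const_mul _), integral_const_mul,
      integral_const_mul, integral_abs_inner_rpow_stdGaussian hθ (by linarith),
      integral_abs_inner_rpow_stdGaussian hφ (by linarith)] at h2
    have h3 := gaussianAbsMoment_two_mul_le hp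
    have h4 : (4 : ℝ) ^ p * gaussianAbsMoment p ^ 2 * 1 ≤
        4 ^ p * gaussianAbsMoment p ^ 2 * (16 * ρ ^ 2) := by
      gcongr; linarith
    nlinarith [sq_nonneg (gaussianAbsMoment p)]

end StdGaussian

/-! ### Variance for an isotropic measure. -/

/-- With `a = z^{1/p}` this is `b^{p-1} |a - b| ≤ |a^p - b^p|`, by monotonicity of `t^{p-1}`. It
holds down to `z = 0`, where the root need not be Lipschitz. -/
theorem Real.abs_rpow_one_div_sub_le {z b p : ℝ} (hz : 0 ≤ z) (hb : 0 < b) (hp : 1 ≤ p) :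
    |z ^ (1 / p) - b| ≤ b ^ (1 - p) * |z - b ^ p| := by
  have hp0 : 0 < p := by linarith
  set a := z ^ (1 / p) with ha
  have ha0 : 0 ≤ a := by positivity
  have haz : z = a ^ p := by
    rw [ha, ← Real.rpow_mul hz, one_div_mul_cancel hp0.ne', Real.rpow_one]
  have e1 : ∀ c : ℝ, 0 ≤ c → c ^ p = c ^ (p - 1) * c := by
    intro c hc
    rcases hc.eq_or_lt with rfl | hc
    · simp [hp0.ne']
    · rw [← Real.rpow_add_one hc.ne']; congr 1; ring
  have e2 : b ^ (1 - p) * b ^ (p - 1) = 1 := by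
    rw [← Real.rpow_add hb]; simp
  have hbp : 0 < b ^ (p - 1) := by positivity
  have key : b ^ (p - 1) * |a - b| ≤ |z - b ^ p| := by
    rw [haz, e1 a ha0, e1 b hb.le]
    rcases le_total a b with hab | hab
    · have : a ^ (p - 1) ≤ b ^ (p - 1) := Real.rpow_le_rpow ha0 hab (by linarith)
      rw [abs_of_nonpos (by linarith)]
      refine le_trans ?_ (neg_le_abs _)
      nlinarith
    · have : b ^ (p - 1) ≤ a ^ (p - 1) := Real.rpow_le_rpow hb.le hab (by linarith)
      rw [abs_of_nonneg (by linarith)]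
      refine le_trans ?_ (le_abs_self _)
      nlinarith
  calc |a - b| = b ^ (1 - p) * (b ^ (p - 1) * |a - b|) := by rw [← mul_assoc, e2, one_mul]
    _ ≤ _ := by gcongr

namespace IsIsotropicMeasure

variable {n : ℕ} {μ : Measure (USphere n)}

local notation "𝔼n" => EuclideanSpace ℝ (Fin n)

theorem integrable_of_continuous (hμ : IsIsotropicMeasure μ) {f : USphere n → ℝ}
    (hf : Continuous f) : Integrable f μ := by
  have := hμ.finite
  obtain ⟨C, hC⟩ := isCompact_univ.exists_bound_of_continuousOn hf.continuousOn
  exact (integrable_const C).mono' hf.aestronglyMeasurable (.of_forall fun x => hC x (Set.mem_univ x))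

/-- Sum the isotropy identity over the standard basis: the integrands add up to `‖θ‖² = 1`. -/
theorem measureReal_univ (hμ : IsIsotropicMeasure μ) : μ.real Set.univ = n := by
  have h : ∀ i : Fin n, ∫ θ : USphere n, (θ : 𝔼n) i ^ 2 ∂μ = 1 := by
    intro i
    have := hμ.isotropic (EuclideanSpace.single i 1)
    simpa [EuclideanSpace.inner_single_left] using this.symm
  have hint : ∀ i ∈ Finset.univ, Integrable (fun θ : USphere n => (θ : 𝔼n) i ^ 2) μ :=
    fun i _ => hμ.integrable_of_continuous (by fun_prop)
  have h2 := integral_finsetSum Finset.univ hint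
  simp only [h, Finset.sum_const, Finset.card_univ, Fintype.card_fin, nsmul_eq_mul, mul_one] at h2
  rw [← h2]
  have h3 : ∀ θ : USphere n, ∑ i, (θ : 𝔼n) i ^ 2 = 1 := by
    intro θ
    rw [← EuclideanSpace.real_norm_sq_eq, norm_eq_of_mem_sphere]; norm_num
  simp [h3]

theorem integral_integral_inner_sq (hμ : IsIsotropicMeasure μ) :
    ∫ θ : USphere n, ∫ φ : USphere n, inner ℝ (θ : 𝔼n) (φ : 𝔼n) ^ 2 ∂μ ∂μ = n := by
  have h : ∀ θ : USphere n, ∫ φ : USphere n, inner ℝ (θ : 𝔼n) (φ : 𝔼n) ^ 2 ∂μ = 1 := by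
    intro θ
    have := hμ.isotropic (θ : 𝔼n)
    simp only [sq_abs, norm_eq_of_mem_sphere] at this
    linarith
  simp [h, hμ.measureReal_univ]

/-- The `p`-th power of the norm `‖·‖_{B_p(μ)}`. -/
noncomputable def _root_.sphereLpIntegral {n : ℕ} (p : ℝ) (μ : Measure (USphere n))
    (x : EuclideanSpace ℝ (Fin n)) : ℝ :=
  ∫ θ : USphere n, |inner ℝ x (θ : EuclideanSpace ℝ (Fin n))| ^ p ∂μ

theorem continuous_abs_inner_rpow {p : ℝ} (hp : 0 ≤ p) :
    Continuous fun z : 𝔼n × USphere n => |inner ℝ z.1 (z.2 : 𝔼n)| ^ p :=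
  (by fun_prop : Continuous fun z : 𝔼n × USphere n =>
    |(inner ℝ z.1 (z.2 : 𝔼n) : ℝ)|).rpow_const fun _ => .inr hp

theorem abs_inner_sphere_le (x : 𝔼n) (θ : USphere n) : |inner ℝ x (θ : 𝔼n)| ≤ ‖x‖ := by
  simpa [norm_eq_of_mem_sphere] using abs_real_inner_le_norm x (θ : 𝔼n)

theorem integrable_prod_abs_inner_rpow (hμ : IsIsotropicMeasure μ) {p : ℝ} (hp : 0 < p) :
    Integrable (fun z : 𝔼n × USphere n => |inner ℝ z.1 (z.2 : 𝔼n)| ^ p)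
      ((stdGaussian 𝔼n).prod μ) := by
  have := hμ.finite
  refine ((integrable_norm_rpow_stdGaussian (E := 𝔼n) hp).comp_fst μ).mono'
    (continuous_abs_inner_rpow hp.le).aestronglyMeasurable (.of_forall fun z => ?_)
  rw [Real.norm_of_nonneg (by positivity)]
  exact Real.rpow_le_rpow (abs_nonneg _) (abs_inner_sphere_le _ _) hp.le

theorem integrable_prod_abs_inner_rpow_mul (hμ : IsIsotropicMeasure μ) {p : ℝ} (hp : 0 < p) :
    Integrable (fun z : 𝔼n × (USphere n × USphere n) =>
      |inner ℝ z.1 (z.2.1 : 𝔼n)| ^ p * |inner ℝ z.1 (z.2.2 : 𝔼n)| ^ p)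
      ((stdGaussian 𝔼n).prod (μ.prod μ)) := by
  have := hμ.finite
  refine ((integrable_norm_rpow_stdGaussian (E := 𝔼n) (add_pos hp hp)).comp_fst (μ.prod μ)).mono'
    (Continuous.aestronglyMeasurable ?_) (.of_forall fun z => ?_)
  · exact ((by fun_prop : Continuous fun z : 𝔼n × (USphere n × USphere n) =>
      |(inner ℝ z.1 (z.2.1 : 𝔼n) : ℝ)|).rpow_const fun _ => .inr hp.le).mul
      ((by fun_prop : Continuous fun z : 𝔼n × (USphere n × USphere n) =>
      |(inner ℝ z.1 (z.2.2 : 𝔼n) : ℝ)|).rpow_const fun _ => .inr hp.le)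
  · rw [Real.norm_of_nonneg (by positivity), Real.rpow_add_of_nonneg (norm_nonneg _) hp.le hp.le]
    have h1 := abs_inner_sphere_le z.1 z.2.1
    have h2 := abs_inner_sphere_le z.1 z.2.2
    gcongr

theorem integral_sphereLpIntegral (hμ : IsIsotropicMeasure μ) {p : ℝ} (hp : 0 < p) :
    ∫ x, sphereLpIntegral p μ x ∂stdGaussian 𝔼n = n * gaussianAbsMoment p := by
  have := hμ.finite
  unfold sphereLpIntegral
  rw [integral_integral_swap (hμ.integrable_prod_abs_inner_rpow hp)]
  have h : ∀ θ : USphere n, ∫ x : 𝔼n, |inner ℝ x (θ : 𝔼n)| ^ p ∂stdGaussian 𝔼n =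
      gaussianAbsMoment p := by
    intro θ
    rw [← integral_abs_inner_rpow_stdGaussian (norm_eq_of_mem_sphere θ) hp.le]
    simp only [real_inner_comm]
  simp [h, hμ.measureReal_univ]

theorem sphereLpIntegral_sq (hμ : IsIsotropicMeasure μ) (p : ℝ) (x : 𝔼n) :
    sphereLpIntegral p μ x ^ 2 = ∫ z : USphere n × USphere n,
      |inner ℝ x (z.1 : 𝔼n)| ^ p * |inner ℝ x (z.2 : 𝔼n)| ^ p ∂μ.prod μ := by
  have := hμ.finite
  rw [integral_prod_mul (fun θ : USphere n => |inner ℝ x (θ : 𝔼n)| ^ p)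
    (fun θ : USphere n => |inner ℝ x (θ : 𝔼n)| ^ p), sq, sphereLpIntegral]

theorem memLp_sphereLpIntegral (hμ : IsIsotropicMeasure μ) {p : ℝ} (hp : 0 < p) :
    MemLp (sphereLpIntegral p μ) 2 (stdGaussian 𝔼n) := by
  have := hμ.finite
  have hm : AEStronglyMeasurable (sphereLpIntegral p μ) (stdGaussian 𝔼n) :=
    (hμ.integrable_prod_abs_inner_rpow hp).integral_prod_left.aestronglyMeasurable
  rw [memLp_two_iff_integrable_sq hm]
  refine (hμ.integrable_prod_abs_inner_rpow_mul hp).integral_prod_left.congr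
    (.of_forall fun x => ?_)
  exact (hμ.sphereLpIntegral_sq p x).symm

theorem integral_sphereLpIntegral_sq_le (hμ : IsIsotropicMeasure μ) {p : ℝ} (hp : 1 ≤ p) :
    ∫ x, sphereLpIntegral p μ x ^ 2 ∂stdGaussian 𝔼n ≤
      gaussianAbsMoment p ^ 2 * (n ^ 2 + 16 * 4 ^ p * n) := by
  have := hμ.finite
  have hp0 : 0 < p := by linarith
  have hI := hμ.integrable_prod_abs_inner_rpow_mul hp0
  have hc : Continuous fun z : USphere n × USphere n => inner ℝ (z.1 : 𝔼n) (z.2 : 𝔼n) ^ 2 := by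
    fun_prop
  have hi : Integrable (fun z : USphere n × USphere n => inner ℝ (z.1 : 𝔼n) (z.2 : 𝔼n) ^ 2)
      (μ.prod μ) := by
    obtain ⟨C, hC⟩ := isCompact_univ.exists_bound_of_continuousOn hc.continuousOn
    exact (integrable_const C).mono' hc.aestronglyMeasurable
      (.of_forall fun x => hC x (Set.mem_univ x))
  have h2 := hμ.integral_integral_inner_sq
  rw [← integral_prod (fun z : USphere n × USphere n => inner ℝ (z.1 : 𝔼n) (z.2 : 𝔼n) ^ 2) hi]
    at h2
  simp only [hμ.sphereLpIntegral_sq p]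
  rw [integral_integral_swap hI]
  calc _ ≤ ∫ z : USphere n × USphere n, gaussianAbsMoment p ^ 2 *
        (1 + 16 * 4 ^ p * inner ℝ (z.1 : 𝔼n) (z.2 : 𝔼n) ^ 2) ∂μ.prod μ := by
        refine integral_mono hI.integral_prod_right
          (((integrable_const 1).add (hi.const_mul _)).const_mul _) fun z => ?_
        have h := integral_abs_inner_rpow_mul_le (norm_eq_of_mem_sphere z.1)
          (norm_eq_of_mem_sphere z.2) hp
        simpa only [real_inner_comm] using h
    _ = _ := by
        rw [integral_const_mul, integral_add (integrable_const 1) (hi.const_mul _),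
          integral_const_mul, h2]
        simp [measureReal_def, ← Set.univ_prod_univ, Measure.prod_prod]
        simp only [← measureReal_def, hμ.measureReal_univ]
        left; ring

theorem integral_sphereLpIntegral_sub_sq_le (hμ : IsIsotropicMeasure μ) {p : ℝ} (hp : 1 ≤ p) :
    ∫ x, (sphereLpIntegral p μ x - n * gaussianAbsMoment p) ^ 2 ∂stdGaussian 𝔼n ≤
      16 * 4 ^ p * n * gaussianAbsMoment p ^ 2 := by
  have hp0 : 0 < p := by linarith
  have hL := hμ.memLp_sphereLpIntegral hp0
  have h1 := hμ.integral_sphereLpIntegral hp0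
  have h2 := hμ.integral_sphereLpIntegral_sq_le hp
  have hv := variance_eq_integral hL.aemeasurable
  rw [h1, variance_eq_sub hL, h1] at hv
  rw [← hv]
  simp only [Pi.pow_apply]
  linarith

theorem memLp_and_variance_sphereLpNorm_le (hμ : IsIsotropicMeasure μ) (hn : 1 ≤ n) {p : ℝ}
    (hp : 1 ≤ p) :
    MemLp (sphereLpNorm p μ) 2 (stdGaussian 𝔼n) ∧
      variance (sphereLpNorm p μ) (stdGaussian 𝔼n) ≤ 512 ^ p * (n : ℝ) ^ (2 / p - 1) := by
  have hp0 : 0 < p := by linarith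
  have hn0 : (0 : ℝ) < n := by exact_mod_cast hn
  have hM := gaussianAbsMoment_pos hp0.le
  set M := gaussianAbsMoment p
  set b := (n * M) ^ (1 / p) with hb
  have hb0 : 0 < b := by positivity
  have hbp : b ^ p = n * M := by
    rw [hb, ← Real.rpow_mul (by positivity), one_div_mul_cancel hp0.ne', Real.rpow_one]
  have hL := hμ.memLp_sphereLpIntegral hp0
  have hD : MemLp (fun x => sphereLpIntegral p μ x - n * M) 2 (stdGaussian 𝔼n) :=
    hL.sub (memLp_const _)
  have hmeas : AEStronglyMeasurable (sphereLpNorm p μ) (stdGaussian 𝔼n) :=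
    (hL.aemeasurable.pow_const (1 / p)).aestronglyMeasurable
  have hpt : ∀ x, |sphereLpNorm p μ x - b| ≤ b ^ (1 - p) * |sphereLpIntegral p μ x - n * M| := by
    intro x
    rw [← hbp]
    exact Real.abs_rpow_one_div_sub_le (integral_nonneg fun θ => by positivity) hb0 hp
  have hNb : MemLp (fun x => sphereLpNorm p μ x - b) 2 (stdGaussian 𝔼n) := by
    refine hD.of_le_mul (c := b ^ (1 - p)) (hmeas.sub aestronglyMeasurable_const)
      (.of_forall fun x => ?_)
    simpa only [Real.norm_eq_abs] using hpt x
  refine ⟨by convert hNb.add (memLp_const b) using 1; ext; simp, ?_⟩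
  -- The constant `b` need not be the mean: the variance is at most the second moment about any
  -- point.
  rw [← variance_sub_const hmeas b]
  calc _ ≤ ∫ x, (sphereLpNorm p μ x - b) ^ 2 ∂stdGaussian 𝔼n :=
        variance_le_expectation_sq hNb.aestronglyMeasurable
    _ ≤ ∫ x, (b ^ (1 - p)) ^ 2 * (sphereLpIntegral p μ x - n * M) ^ 2 ∂stdGaussian 𝔼n := by
        refine integral_mono hNb.integrable_sq (hD.integrable_sq.const_mul _) fun x => ?_
        have := pow_le_pow_left₀ (abs_nonneg _) (hpt x) 2
        simpa only [mul_pow, sq_abs] using this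
    _ ≤ (b ^ (1 - p)) ^ 2 * (16 * 4 ^ p * n * M ^ 2) := by
        rw [integral_const_mul]
        gcongr
        exact hμ.integral_sphereLpIntegral_sub_sq_le hp
    _ = 16 * 4 ^ p * n ^ (2 / p - 1) * M ^ (2 / p) := by
        have e : (b ^ (1 - p)) ^ 2 = (n : ℝ) ^ (2 / p - 2) * M ^ (2 / p - 2) := by
          rw [← Real.mul_rpow hn0.le hM.le, hb, ← Real.rpow_mul (by positivity),
            ← Real.rpow_mul_natCast (by positivity)]
          congr 1; push_cast; field_simp
        have e1 : (n : ℝ) ^ (2 / p - 1) = n ^ (2 / p - 2) * n := by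
          rw [← Real.rpow_add_one hn0.ne']; congr 1; ring
        have e2 : M ^ (2 / p) = M ^ (2 / p - 2) * M ^ 2 := by
          rw [← Real.rpow_natCast, ← Real.rpow_add hM]; congr 1; push_cast; ring
        rw [e, e1, e2]; ring
    -- The final constant is `512 = 16 · 4 · 8`; the numerical 16 is absorbed into `16^p` since `p ≥
    -- 1`.
    _ ≤ 16 ^ p * 4 ^ p * n ^ (2 / p - 1) * 8 ^ p := by
        gcongr
        · exact Real.self_le_rpow_of_one_le (by norm_num) hp
        · exact gaussianAbsMoment_rpow_two_div_le hp
    _ = _ := by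
        rw [show (512 : ℝ) = 16 * 4 * 8 by norm_num, Real.mul_rpow (by norm_num) (by norm_num),
          Real.mul_rpow (by norm_num) (by norm_num)]
        ring

end IsIsotropicMeasure

/-! ### Lewis' lemma by maximizing a determinant. -/

section Lewis

variable {Ω : Type*} [MeasurableSpace Ω] {ν : Measure Ω}
  {E : Type*} [NormedAddCommGroup E] [InnerProductSpace ℝ E]
  {V : Ω → E} {p : ℝ}

theorem aestronglyMeasurable_norm_clm_rpow (hVm : StronglyMeasurable V) (hp : 0 ≤ p)
    (A : E →L[ℝ] E) : AEStronglyMeasurable (fun ω => ‖A (V ω)‖ ^ p) ν :=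
  ((continuous_norm.rpow_const fun _ => .inr hp).comp_stronglyMeasurable
    (A.continuous.comp_stronglyMeasurable hVm)).aestronglyMeasurable

theorem norm_clm_rpow_le (hp : 0 ≤ p) (A : E →L[ℝ] E) (v : E) :
    ‖A v‖ ^ p ≤ ‖A‖ ^ p * ‖v‖ ^ p := by
  rw [← Real.mul_rpow (norm_nonneg _) (norm_nonneg _)]
  exact Real.rpow_le_rpow (norm_nonneg _) (A.le_opNorm v) hp

theorem integrable_norm_clm_rpow (hVm : StronglyMeasurable V) (hp : 0 ≤ p)
    (hV : Integrable (fun ω => ‖V ω‖ ^ p) ν) (A : E →L[ℝ] E) :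
    Integrable (fun ω => ‖A (V ω)‖ ^ p) ν := by
  refine (hV.const_mul (‖A‖ ^ p)).mono' (aestronglyMeasurable_norm_clm_rpow hVm hp A)
    (.of_forall fun ω => ?_)
  rw [Real.norm_of_nonneg (by positivity)]
  exact norm_clm_rpow_le hp A _

theorem norm_add_smul_inner_smul_rpow {u D : E} (hu : ‖u‖ = 1) (hD : ‖D‖ = 1) (t p : ℝ) :
    ‖D + (t * inner ℝ u D) • u‖ ^ p = (1 + (2 * t + t ^ 2) * inner ℝ u D ^ 2) ^ (p / 2) := by
  have h : ‖D + (t * inner ℝ u D) • u‖ ^ 2 = 1 + (2 * t + t ^ 2) * inner ℝ u D ^ 2 := by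
    rw [norm_add_sq_real, hD, inner_smul_right, norm_smul, hu, real_inner_comm, mul_one,
      Real.norm_eq_abs, sq_abs]
    ring
  rw [← h, ← Real.rpow_natCast, ← Real.rpow_mul (norm_nonneg _)]
  congr 1; push_cast; ring

theorem continuous_integral_norm_clm_rpow (hVm : StronglyMeasurable V) (hp : 0 < p)
    (hV : Integrable (fun ω => ‖V ω‖ ^ p) ν) :
    Continuous fun A : E →L[ℝ] E => ∫ ω, ‖A (V ω)‖ ^ p ∂ν := by
  refine continuous_iff_continuousAt.2 fun A₀ => ?_
  refine continuousAt_of_dominated (bound := fun ω => (‖A₀‖ + 1) ^ p * ‖V ω‖ ^ p)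
    (.of_forall fun A => aestronglyMeasurable_norm_clm_rpow hVm hp.le A) ?_ (hV.const_mul _)
    (.of_forall fun ω => ?_)
  · have h : ∀ᶠ A : E →L[ℝ] E in nhds A₀, ‖A‖ < ‖A₀‖ + 1 :=
      continuous_norm.continuousAt.eventually_lt_const (by linarith)
    filter_upwards [h] with A hA
    refine .of_forall fun ω => ?_
    rw [Real.norm_of_nonneg (by positivity)]
    exact (norm_clm_rpow_le hp.le A _).trans (by gcongr)
  · exact (((ContinuousLinearMap.apply ℝ E (V ω)).continuous.norm).rpow_const
      fun _ => .inr hp.le).continuousAt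

variable [FiniteDimensional ℝ E]

/-- The lower bound `hlow` makes `{Φ ≤ 1}` compact, so `|det|` attains its maximum there.
Homogeneity of `Φ` makes the maximality scale-free, and multiplicativity of `det` recentres it at
the identity. -/
theorem exists_maximal_det [Nontrivial E] (hVm : StronglyMeasurable V) (hp : 0 < p)
    (hV : Integrable (fun ω => ‖V ω‖ ^ p) ν) {c : ℝ} (hc : 0 < c)
    (hlow : ∀ a : E, c * ‖a‖ ^ p ≤ ∫ ω, |inner ℝ a (V ω)| ^ p ∂ν) :
    ∃ A : E →L[ℝ] E, A.det ≠ 0 ∧ ∫ ω, ‖A (V ω)‖ ^ p ∂ν = 1 ∧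
      ∀ B : E →L[ℝ] E, B.det ≠ 0 →
        |B.det| ≤ (∫ ω, ‖B (A (V ω))‖ ^ p ∂ν) ^ (Module.finrank ℝ E / p) := by
  set Φ : (E →L[ℝ] E) → ℝ := fun A => ∫ ω, ‖A (V ω)‖ ^ p ∂ν with hΦ
  have hΦ0 : ∀ A, 0 ≤ Φ A := fun A => integral_nonneg fun ω => by positivity
  have hΦc : Continuous Φ := continuous_integral_norm_clm_rpow hVm hp hV
  -- For a unit vector `a`, `|⟨A* a, V⟩| = |⟨a, A V⟩| ≤ ‖A V‖`, so `Φ` controls the norm of the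
  -- adjoint.
  have hΦlow : ∀ (A : E →L[ℝ] E) (a : E), ‖a‖ = 1 → c * ‖A.adjoint a‖ ^ p ≤ Φ A := by
    intro A a ha
    refine (hlow _).trans (integral_mono_of_nonneg (.of_forall fun ω => by positivity)
      (integrable_norm_clm_rpow hVm hp.le hV A) (.of_forall fun ω => ?_))
    simp only
    rw [ContinuousLinearMap.adjoint_inner_left]
    refine Real.rpow_le_rpow (abs_nonneg _) ?_ hp.le
    simpa [ha] using abs_real_inner_le_norm a (A (V ω))
  have hΦpos : ∀ A : E →L[ℝ] E, A.det ≠ 0 → 0 < Φ A := by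
    intro A hA
    refine (hΦ0 A).lt_of_ne' fun h0 => hA ?_
    have h1 : A.adjoint = 0 := by
      rw [← norm_le_zero_iff]
      refine ContinuousLinearMap.opNorm_le_of_unit_norm le_rfl fun a ha => ?_
      have := hΦlow A a ha
      rw [h0] at this
      by_contra! h
      have : 0 < c * ‖A.adjoint a‖ ^ p := by positivity
      linarith
    have h2 : A = 0 := by simpa using congrArg ContinuousLinearMap.adjoint h1
    rw [h2, ContinuousLinearMap.det, ContinuousLinearMap.toLinearMap_zero,
      LinearMap.det_zero, zero_pow Module.finrank_pos.ne']
  have hΦsmul : ∀ (t : ℝ) (A : E →L[ℝ] E), 0 ≤ t → Φ (t • A) = t ^ p * Φ A := by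
    intro t A ht
    simp only [hΦ]
    rw [← integral_const_mul]
    refine integral_congr_ae (.of_forall fun ω => ?_)
    simp only [_root_.smul_apply, norm_smul, Real.norm_of_nonneg ht]
    rw [Real.mul_rpow ht (norm_nonneg _)]
  set K : Set (E →L[ℝ] E) := {A | Φ A ≤ 1} with hK
  have hKc : IsCompact K := by
    refine Metric.isCompact_of_isClosed_isBounded (isClosed_le hΦc continuous_const) ?_
    refine (Metric.isBounded_closedBall (x := (0 : E →L[ℝ] E)) (r := (1 / c) ^ (1 / p))).subset
      fun A hA => ?_
    rw [mem_closedBall_zero_iff, ← LinearIsometryEquiv.norm_map ContinuousLinearMap.adjoint A]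
    refine ContinuousLinearMap.opNorm_le_of_unit_norm (by positivity) fun a ha => ?_
    have h1 := (hΦlow A a ha).trans hA
    have h2 : ‖A.adjoint a‖ ^ p ≤ 1 / c := by rw [le_div_iff₀ hc]; linarith
    calc ‖A.adjoint a‖ = (‖A.adjoint a‖ ^ p) ^ (1 / p) := by
          rw [← Real.rpow_mul (norm_nonneg _), mul_one_div_cancel hp.ne', Real.rpow_one]
      _ ≤ _ := by gcongr
  have hK0 : (0 : E →L[ℝ] E) ∈ K := by
    simp [hK, hΦ, Real.zero_rpow hp.ne']
  obtain ⟨A, hAK, hAmax⟩ := hKc.exists_isMaxOn ⟨0, hK0⟩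
    (ContinuousLinearMap.continuous_det.abs.continuousOn :
      ContinuousOn (fun A : E →L[ℝ] E => |A.det|) K)
  have hmax : ∀ B : E →L[ℝ] E, B.det ≠ 0 →
      |B.det| ≤ |A.det| * Φ B ^ (Module.finrank ℝ E / p) := by
    intro B hB
    have hB0 := hΦpos B hB
    -- This scale normalizes `Φ (t • B)` to `1`.
    set t := Φ B ^ (-(1 / p)) with ht
    have ht0 : 0 < t := by positivity
    have htK : t • B ∈ K := by
      simp only [hK, Set.mem_ofPred_eq]
      rw [hΦsmul t B ht0.le, ht, ← Real.rpow_mul hB0.le,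
        show -(1 / p) * p = -1 by field_simp, Real.rpow_neg_one, inv_mul_cancel₀ hB0.ne']
    have h1 := hAmax htK
    simp only [Set.mem_ofPred_eq] at h1
    have h2 : (t • B).det = t ^ Module.finrank ℝ E * B.det := by
      rw [ContinuousLinearMap.det, ContinuousLinearMap.toLinearMap_smul, LinearMap.det_smul]
    rw [h2, abs_mul, abs_of_pos (by positivity)] at h1
    have h3 : t ^ Module.finrank ℝ E * Φ B ^ (Module.finrank ℝ E / p : ℝ) = 1 := by
      rw [ht, ← Real.rpow_mul_natCast hB0.le, ← Real.rpow_add hB0]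
      convert Real.rpow_zero _ using 2
      ring
    calc |B.det| = (t ^ Module.finrank ℝ E * |B.det|) * Φ B ^ (Module.finrank ℝ E / p : ℝ) := by
          rw [mul_right_comm, h3, one_mul]
      _ ≤ _ := by gcongr
  have hA0 : A.det ≠ 0 := by
    intro h
    have := hmax (ContinuousLinearMap.id ℝ E) (by simp [ContinuousLinearMap.det])
    rw [h] at this
    simp [ContinuousLinearMap.det] at this
    linarith
  have hB : ∀ B : E →L[ℝ] E, B.det ≠ 0 →
      |B.det| ≤ Φ (B ∘L A) ^ (Module.finrank ℝ E / p : ℝ) := by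
    intro B hB
    have hd : (B ∘L A).det = B.det * A.det := by
      simp only [ContinuousLinearMap.det, ContinuousLinearMap.toLinearMap_comp, LinearMap.det_comp]
    have := hmax (B ∘L A) (by rw [hd]; exact mul_ne_zero hB hA0)
    rw [hd, abs_mul, mul_comm] at this
    exact le_of_mul_le_mul_left this (abs_pos.2 hA0)
  refine ⟨A, hA0, le_antisymm hAK ?_, hB⟩
  by_contra! h
  have h1 := hB (ContinuousLinearMap.id ℝ E) (by simp [ContinuousLinearMap.det])
  rw [ContinuousLinearMap.id_comp] at h1
  have h2 : Φ A ^ (Module.finrank ℝ E / p : ℝ) < 1 :=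
    Real.rpow_lt_one (hΦ0 A) h (by have := Module.finrank_pos (R := ℝ) (M := E); positivity)
  simp [ContinuousLinearMap.det] at h1
  linarith

/-- For `|t| < 1/4` the base stays in `[1/2, 2]`, so its power `p/2 - 1`, possibly negative, is
bounded and dominated differentiation applies. -/
theorem hasDerivAt_integral_one_add_mul_rpow {w r : Ω → ℝ} (hw : Integrable w ν)
    (hw0 : ∀ ω, 0 ≤ w ω) (hr : AEStronglyMeasurable r ν) (hr0 : ∀ ω, 0 ≤ r ω)
    (hr1 : ∀ ω, r ω ≤ 1) (p : ℝ) :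
    HasDerivAt (fun t : ℝ => ∫ ω, w ω * (1 + (2 * t + t ^ 2) * r ω) ^ (p / 2) ∂ν)
      (p * ∫ ω, w ω * r ω ∂ν) 0 := by
  have hbase : ∀ t ∈ Metric.ball (0 : ℝ) (1 / 4), ∀ ω,
      1 / 2 ≤ 1 + (2 * t + t ^ 2) * r ω ∧ 1 + (2 * t + t ^ 2) * r ω ≤ 2 := by
    intro t ht ω
    rw [mem_ball_zero_iff, Real.norm_eq_abs, abs_lt] at ht
    have h0 := hr0 ω
    have h1 := hr1 ω
    have h2 : -(1 / 2) ≤ 2 * t + t ^ 2 := by nlinarith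
    have h3 : 2 * t + t ^ 2 ≤ 1 := by nlinarith
    constructor <;> nlinarith
  have h := hasDerivAt_integral_of_dominated_loc_of_deriv_le (μ := ν) (𝕜 := ℝ) (x₀ := (0 : ℝ))
    (F := fun t ω => w ω * (1 + (2 * t + t ^ 2) * r ω) ^ (p / 2))
    (F' := fun t ω => w ω * ((2 + 2 * t) * r ω * (p / 2) *
      (1 + (2 * t + t ^ 2) * r ω) ^ (p / 2 - 1)))
    (bound := fun ω => w ω * (3 * |p / 2| * 2 ^ |p / 2 - 1|))
    (Metric.ball_mem_nhds 0 (by norm_num : (0 : ℝ) < 1 / 4))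
    (.of_forall fun t => AEMeasurable.aestronglyMeasurable
      (by have := hr.aemeasurable; have := hw.aemeasurable; fun_prop))
    (by simpa using hw)
    (AEMeasurable.aestronglyMeasurable
      (by have := hr.aemeasurable; have := hw.aemeasurable; fun_prop))
    (.of_forall fun ω t ht => ?_) (hw.mul_const _) (.of_forall fun ω t ht => ?_)
  · refine h.2.congr_deriv ?_
    rw [← integral_const_mul]
    refine integral_congr_ae (.of_forall fun ω => ?_)
    simp; ring
  · obtain ⟨h1, h2⟩ := hbase t ht ω
    rw [mem_ball_zero_iff, Real.norm_eq_abs, abs_lt] at ht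
    rw [norm_mul, Real.norm_of_nonneg (hw0 ω)]
    refine mul_le_mul_of_nonneg_left ?_ (hw0 ω)
    have h3 : (1 + (2 * t + t ^ 2) * r ω) ^ (p / 2 - 1) ≤ 2 ^ |p / 2 - 1| := by
      rcases le_total 0 (p / 2 - 1) with hq | hq
      · rw [abs_of_nonneg hq]
        exact Real.rpow_le_rpow (by linarith) h2 hq
      · rw [abs_of_nonpos hq]
        calc _ ≤ (1 / 2 : ℝ) ^ (p / 2 - 1) := Real.rpow_le_rpow_of_nonpos (by norm_num) h1 hq
          _ = _ := by rw [one_div, Real.inv_rpow (by norm_num), ← Real.rpow_neg (by norm_num)]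
    have h4 : |(2 + 2 * t) * r ω| ≤ 3 := by
      have := hr0 ω
      have := hr1 ω
      rw [abs_of_nonneg (by nlinarith)]
      nlinarith
    rw [norm_mul, norm_mul, Real.norm_eq_abs, Real.norm_eq_abs,
      Real.norm_of_nonneg (Real.rpow_nonneg (by linarith) _)]
    gcongr
  · obtain ⟨h1, -⟩ := hbase t ht ω
    have e : HasDerivAt (fun t : ℝ => 1 + (2 * t + t ^ 2) * r ω) ((2 + 2 * t) * r ω) t := by
      have h3 : HasDerivAt (fun t : ℝ => 2 * t + t ^ 2) (2 + 2 * t) t := by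
        simpa using ((hasDerivAt_id' t).const_mul 2).fun_add (hasDerivAt_pow 2 t)
      exact (h3.mul_const (r ω)).const_add 1
    exact (e.rpow_const (.inl (by linarith))).const_mul _

/-- Lewis' lemma: after a linear change of variables the direction of `V`, weighted by `‖V‖ ^ p`,
is isotropic. -/
theorem exists_det_ne_zero_forall_integral_eq [Nontrivial E] (hVm : StronglyMeasurable V)
    (hp : 0 < p) (hV : Integrable (fun ω => ‖V ω‖ ^ p) ν) {c : ℝ} (hc : 0 < c)
    (hlow : ∀ a : E, c * ‖a‖ ^ p ≤ ∫ ω, |inner ℝ a (V ω)| ^ p ∂ν) :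
    ∃ A : E →L[ℝ] E, A.det ≠ 0 ∧ ∀ D : Ω → E, StronglyMeasurable D → (∀ ω, ‖D ω‖ = 1) →
      (∀ ω, A (V ω) = ‖A (V ω)‖ • D ω) →
      ∀ x : E, ∫ ω, ‖A (V ω)‖ ^ p * |inner ℝ x (D ω)| ^ 2 ∂ν = ‖x‖ ^ 2 := by
  obtain ⟨A, hA0, hA1, hA⟩ := exists_maximal_det hVm hp hV hc hlow
  have hn : (0 : ℝ) < Module.finrank ℝ E := by exact_mod_cast Module.finrank_pos
  obtain ⟨N, hN⟩ : ∃ N : ℝ, N = Module.finrank ℝ E := ⟨_, rfl⟩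
  rw [← hN] at hn hA
  have main : ∀ D : Ω → E, StronglyMeasurable D → (∀ ω, ‖D ω‖ = 1) →
      (∀ ω, A (V ω) = ‖A (V ω)‖ • D ω) → ∀ u : E, ‖u‖ = 1 →
      ∫ ω, ‖A (V ω)‖ ^ p * inner ℝ u (D ω) ^ 2 ∂ν = 1 / N := by
    intro D hDm hD1 hD u hu
    have hr : StronglyMeasurable fun ω => (inner ℝ u (D ω) : ℝ) ^ 2 :=
      (by fun_prop : Continuous fun x : E => (inner ℝ u x : ℝ) ^ 2).comp_stronglyMeasurable hDm
    have hder := hasDerivAt_integral_one_add_mul_rpow (integrable_norm_clm_rpow hVm hp.le hV A)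
      (fun ω => by positivity) (hr.aestronglyMeasurable (μ := ν)) (fun ω => by positivity)
      (fun ω => by
        have := abs_real_inner_le_norm u (D ω)
        rw [hu, hD1, one_mul] at this
        rw [← sq_abs]
        exact pow_le_one₀ (abs_nonneg _) this) p
    set I := ∫ ω, ‖A (V ω)‖ ^ p * inner ℝ u (D ω) ^ 2 ∂ν
    set G : ℝ → ℝ := fun t => ∫ ω, ‖A (V ω)‖ ^ p *
      (1 + (2 * t + t ^ 2) * inner ℝ u (D ω) ^ 2) ^ (p / 2) ∂ν with hG
    have hG0 : G 0 = 1 := by simp [hG, hA1]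
    have hGt : ∀ t : ℝ, -1 < t → 1 + t ≤ G t ^ (N / p) := by
      intro t ht
      -- The perturbation `x ↦ x + t ⟨u, x⟩ u` has determinant `1 + t`.
      set B : E →L[ℝ] E := LinearMap.toContinuousLinearMap
        (LinearMap.transvection (t • (innerₛₗ ℝ u)) u) with hB
      have hBdet : B.det = 1 + t := by
        rw [ContinuousLinearMap.det, hB, LinearMap.coe_toContinuousLinearMap,
          LinearMap.transvection.det]
        simp [hu]
      have h1 := hA B (by rw [hBdet]; linarith)
      rw [hBdet, abs_of_pos (by linarith)] at h1
      refine h1.trans_eq (congrArg (· ^ (N / p)) (integral_congr_ae (.of_forall fun ω => ?_)))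
      have e : B (A (V ω)) = ‖A (V ω)‖ • (D ω + (t * inner ℝ u (D ω)) • u) := by
        conv_lhs => rw [hD ω]
        rw [map_smul]
        congr 1
      simp only
      rw [e, norm_smul, norm_norm, Real.mul_rpow (norm_nonneg _) (norm_nonneg _),
        norm_add_smul_inner_smul_rpow hu (hD1 ω)]
    -- Equality holds at `t = 0`, so the derivative `N I - 1` vanishes there.
    have hmin : IsLocalMin (fun t => G t ^ (N / p) - (1 + t)) 0 := by
      filter_upwards [lt_mem_nhds (show (-1 : ℝ) < 0 by norm_num)] with t ht
      have := hGt t ht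
      simp only [hG0, Real.one_rpow]
      linarith
    have hd := (hder.rpow_const (p := N / p) (.inl (by rw [hG0]; norm_num))).sub
      ((hasDerivAt_id (0 : ℝ)).const_add 1)
    have h0 := hmin.hasDerivAt_eq_zero hd
    change p * I * (N / p) * G 0 ^ (N / p - 1) - 1 = 0 at h0
    rw [hG0, Real.one_rpow] at h0
    field_simp at h0 ⊢
    linarith
  -- Scaling `A` by `N^{1/p}` multiplies the weight by `N`, turning `1/N` into `1`, and leaves the
  -- directions unchanged.
  set l : ℝ := N ^ (1 / p) with hl
  have hl0 : 0 < l := by positivity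
  have hlp : l ^ p = N := by
    rw [hl, ← Real.rpow_mul hn.le, one_div_mul_cancel hp.ne', Real.rpow_one]
  refine ⟨l • A, ?_, fun D hDm hD1 hD x => ?_⟩
  · rw [ContinuousLinearMap.det, ContinuousLinearMap.toLinearMap_smul, LinearMap.det_smul]
    exact mul_ne_zero (by positivity) hA0
  · have hD' : ∀ ω, A (V ω) = ‖A (V ω)‖ • D ω := by
      intro ω
      have := hD ω
      rw [_root_.smul_apply, norm_smul, Real.norm_of_nonneg hl0.le, mul_smul] at this
      exact smul_right_injective E hl0.ne' this
    rcases eq_or_ne x 0 with rfl | hx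
    · simp
    · have hx0 : ‖x‖ ≠ 0 := norm_ne_zero_iff.2 hx
      have h := main D hDm hD1 hD' (‖x‖⁻¹ • x) (by rw [norm_smul, norm_inv, norm_norm,
        inv_mul_cancel₀ hx0])
      have e : ∀ ω, ‖(l • A) (V ω)‖ ^ p * |inner ℝ x (D ω)| ^ 2 =
          (N * ‖x‖ ^ 2) * (‖A (V ω)‖ ^ p * inner ℝ (‖x‖⁻¹ • x) (D ω) ^ 2) := by
        intro ω
        rw [_root_.smul_apply, norm_smul, Real.norm_of_nonneg hl0.le,
          Real.mul_rpow hl0.le (norm_nonneg _), hlp, inner_smul_left, sq_abs]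
        simp only [conj_trivial]
        field_simp
      simp only [e]
      rw [integral_const_mul, h]
      field_simp

end Lewis

/-! ### Construction of the Lewis position. -/

/-- Push `w dν` forward by `D` and average with the reflected measure; integrals of even functions
do not change. -/
theorem exists_even_measure_integral_eq {Ω : Type*} [MeasurableSpace Ω] {ν : Measure Ω} {n : ℕ}
    {w : Ω → ℝ} (hwm : Measurable w) (hw : Integrable w ν) (hw0 : ∀ ω, 0 ≤ w ω)
    {D : Ω → USphere n} (hD : Measurable D) :
    ∃ μ : Measure (USphere n), IsFiniteMeasure μ ∧ μ.map (fun θ => -θ) = μ ∧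
      ∀ f : USphere n → ℝ, Continuous f → (∀ θ, f (-θ) = f θ) →
        ∫ θ, f θ ∂μ = ∫ ω, w ω * f (D ω) ∂ν := by
  have hneg : Measurable fun θ : USphere n => -θ := continuous_neg.measurable
  set κ := ν.withDensity fun ω => ((w ω).toNNReal : ENNReal) with hκ
  have hκf : IsFiniteMeasure κ := isFiniteMeasure_withDensity_ofReal hw.2
  set μ₀ := κ.map D with hμ₀
  have hμ₀f : IsFiniteMeasure μ₀ := inferInstance
  have hnn : (μ₀.map fun θ => -θ).map (fun θ => -θ) = μ₀ := by
    rw [Measure.map_map hneg hneg]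
    simp
  refine ⟨(2⁻¹ : NNReal) • (μ₀ + μ₀.map fun θ => -θ), inferInstance, ?_, fun f hf hfe => ?_⟩
  · rw [Measure.map_smul, Measure.map_add _ _ hneg, hnn, add_comm]
  · have hint : ∀ (m : Measure (USphere n)) [IsFiniteMeasure m], Integrable f m := by
      intro m _
      obtain ⟨C, hC⟩ := isCompact_univ.exists_bound_of_continuousOn hf.continuousOn
      exact (integrable_const C).mono' hf.aestronglyMeasurable
        (.of_forall fun x => hC x (Set.mem_univ x))
    have h0 : ∫ θ, f θ ∂μ₀ = ∫ ω, w ω * f (D ω) ∂ν := by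
      rw [hμ₀, integral_map hD.aemeasurable hf.aestronglyMeasurable, hκ,
        integral_withDensity_eq_integral_smul hwm.real_toNNReal]
      refine integral_congr_ae (.of_forall fun ω => ?_)
      simp [NNReal.smul_def, Real.coe_toNNReal _ (hw0 ω)]
    have h1 : ∫ θ, f θ ∂μ₀.map (fun θ => -θ) = ∫ θ, f θ ∂μ₀ := by
      rw [integral_map hneg.aemeasurable hf.aestronglyMeasurable]
      simp only [hfe]
    rw [integral_smul_nnreal_measure, integral_add_measure (hint _) (hint _), h1, h0,
      NNReal.smul_def]
    simp; ring

theorem gauge_image_closedBall {X E : Type*} [NormedAddCommGroup X] [NormedSpace ℝ X]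
    [AddCommGroup E] [Module ℝ E] (T : X ≃ₗ[ℝ] E) (x : E) :
    gauge (T '' Metric.closedBall (0 : X) 1) x = ‖T.symm x‖ := by
  have h : gauge (T '' Metric.closedBall (0 : X) 1) x =
      gauge (Metric.closedBall (0 : X) 1) (T.symm x) := by
    simp only [gauge_def]
    congr 1
    ext r
    rw [Set.mem_sep_iff, Set.mem_sep_iff, ← image_smul_set, T.image_eq_preimage_symm,
      Set.mem_preimage]
  rw [h, gauge_closedBall zero_le_one, div_one]

theorem exists_direction {Ω : Type*} [MeasurableSpace Ω] {n : ℕ} (hn : 1 ≤ n)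
    {W : Ω → EuclideanSpace ℝ (Fin n)} (hW : Measurable W) :
    ∃ D : Ω → USphere n, Measurable D ∧
      ∀ ω, W ω = ‖W ω‖ • (D ω : EuclideanSpace ℝ (Fin n)) := by
  classical
  set e : EuclideanSpace ℝ (Fin n) := EuclideanSpace.single ⟨0, hn⟩ 1 with he
  have he1 : ‖e‖ = 1 := by simp [he]
  -- Where `W` vanishes any unit vector serves, since it is multiplied by `‖W ω‖ = 0`.
  set D : Ω → EuclideanSpace ℝ (Fin n) := fun ω => if W ω = 0 then e else ‖W ω‖⁻¹ • W ω with hD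
  have hD1 : ∀ ω, D ω ∈ Metric.sphere (0 : EuclideanSpace ℝ (Fin n)) 1 := by
    intro ω
    rw [mem_sphere_zero_iff_norm]
    by_cases h : W ω = 0
    · simp [hD, h, he1]
    · simp [hD, h, norm_smul]
  have hDm : Measurable D :=
    Measurable.ite (hW (measurableSet_singleton 0)) measurable_const (hW.norm.inv.smul hW)
  refine ⟨fun ω => ⟨D ω, hD1 ω⟩, hDm.subtype_mk, fun ω => ?_⟩
  by_cases h : W ω = 0
  · simp [h]
  · simp [hD, h]

/-- Collect representatives of a basis of `X` into one vector function `V`; the combination with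
coefficients `a` is then `⟨a, V⟩` almost everywhere. -/
theorem exists_linearEquiv_norm_rpow_eq {p : ENNReal} [Fact (1 ≤ p)] (hp : p ≠ ⊤) {Ω : Type*}
    [MeasurableSpace Ω] {ν : Measure Ω} (X : Submodule ℝ (Lp ℝ p ν)) {n : ℕ} (hn : 1 ≤ n)
    (hX : Module.finrank ℝ X = n) :
    ∃ (S : EuclideanSpace ℝ (Fin n) ≃ₗ[ℝ] X) (V : Ω → EuclideanSpace ℝ (Fin n)),
      StronglyMeasurable V ∧ Integrable (fun ω => ‖V ω‖ ^ p.toReal) ν ∧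
      ∀ a, ‖S a‖ ^ p.toReal = ∫ ω, |inner ℝ a (V ω)| ^ p.toReal ∂ν := by
  have hp1 : 1 ≤ p := Fact.out
  have hp0 : p ≠ 0 := (one_pos.trans_le hp1).ne'
  have hpr : 0 < p.toReal := ENNReal.toReal_pos hp0 hp
  have : Module.Finite ℝ X := Module.finite_of_finrank_pos (by omega)
  set b : Module.Basis (Fin n) ℝ X := Module.finBasisOfFinrankEq ℝ X hX with hb
  set f : Fin n → Lp ℝ p ν := fun i => (b i : Lp ℝ p ν) with hf
  set V : Ω → EuclideanSpace ℝ (Fin n) := fun ω => WithLp.toLp 2 fun i => f i ω with hV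
  have hVm : Measurable V := by
    refine (WithLp.measurable_toLp 2 _).comp (measurable_pi_iff.2 fun i => ?_)
    exact (Lp.stronglyMeasurable (f i)).measurable
  have hVL : MemLp V p ν := MemLp.of_eval_piLp fun i => Lp.memLp (f i)
  refine ⟨(WithLp.linearEquiv 2 ℝ (Fin n → ℝ)).trans b.equivFun.symm, V,
    hVm.stronglyMeasurable, hVL.integrable_norm_rpow hp0 hp, fun a => ?_⟩
  have h1 : (((WithLp.linearEquiv 2 ℝ (Fin n → ℝ)).trans b.equivFun.symm a : X) : Lp ℝ p ν) =
      ∑ i, a i • f i := by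
    simp [Module.Basis.equivFun_symm_apply, hf]
  have h2 : (∑ i, a i • f i : Lp ℝ p ν) =ᵐ[ν] fun ω => inner ℝ a (V ω) := by
    have h3 : ∀ᵐ ω ∂ν, ∀ i, (a i • f i : Lp ℝ p ν) ω = a i * f i ω := by
      rw [ae_all_iff]
      intro i
      filter_upwards [Lp.coeFn_smul (a i) (f i)] with ω hω
      simpa using hω
    filter_upwards [Lp.coeFn_finsetSum Finset.univ fun i => a i • f i, h3] with ω h4 h5
    rw [h4, Finset.sum_apply]
    simp only [h5, PiLp.inner_apply, hV, RCLike.inner_apply, conj_trivial]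
    exact Finset.sum_congr rfl fun i _ => mul_comm _ _
  rw [Submodule.coe_norm, h1, Lp.norm_def,
    MemLp.eLpNorm_eq_integral_rpow_norm hp0 hp (Lp.memLp _),
    ENNReal.toReal_ofReal (by positivity),
    ← Real.rpow_mul (integral_nonneg fun ω => by positivity), inv_mul_cancel₀ hpr.ne',
    Real.rpow_one]
  refine integral_congr_ae ?_
  filter_upwards [h2] with ω hω
  rw [hω, Real.norm_eq_abs]

theorem exists_isLewisPosition {p : ENNReal} [Fact (1 ≤ p)] (hp : p ≠ ⊤) {Ω : Type*}
    [MeasurableSpace Ω] {ν : Measure Ω} (X : Submodule ℝ (Lp ℝ p ν)) {n : ℕ} (hn : 1 ≤ n)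
    (hX : Module.finrank ℝ X = n) :
    ∃ B : Set (EuclideanSpace ℝ (Fin n)), IsLewisPosition p.toReal X B := by
  have hp1 : 1 ≤ p := Fact.out
  have hpr : 0 < p.toReal := ENNReal.toReal_pos (one_pos.trans_le hp1).ne' hp
  have : Nonempty (Fin n) := ⟨⟨0, hn⟩⟩
  obtain ⟨S, V, hVm, hV, hS⟩ := exists_linearEquiv_norm_rpow_eq hp X hn hX
  set q := p.toReal
  have : FiniteDimensional ℝ X := Module.finite_of_finrank_pos (by omega)
  -- The inverse of `S` is bounded in finite dimension, which supplies the lower bound needed by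
  -- Lewis' lemma; the added `1` keeps `K` positive.
  obtain ⟨K, hK0, hK⟩ : ∃ K : ℝ, 0 < K ∧ ∀ a, ‖a‖ ≤ K * ‖S a‖ := by
    set R := LinearMap.toContinuousLinearMap (S.symm : X →ₗ[ℝ] EuclideanSpace ℝ (Fin n))
    refine ⟨‖R‖ + 1, by positivity, fun a => ?_⟩
    have h := R.le_opNorm (S a)
    have h2 : R (S a) = a := S.symm_apply_apply a
    rw [h2] at h
    nlinarith [norm_nonneg (S a)]
  obtain ⟨A, hA0, hA⟩ := exists_det_ne_zero_forall_integral_eq hVm hpr hV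
    (c := (K ^ q)⁻¹) (by positivity) fun a => by
      rw [← hS, inv_mul_le_iff₀ (by positivity), ← Real.mul_rpow hK0.le (norm_nonneg _)]
      exact Real.rpow_le_rpow (norm_nonneg _) (hK a) hpr.le
  obtain ⟨D, hDm, hD⟩ := exists_direction hn (A.continuous.measurable.comp hVm.measurable)
  simp only [Function.comp_apply] at hD
  have hiso := hA (fun ω => D ω) (measurable_subtype_coe.comp hDm).stronglyMeasurable
    (fun ω => norm_eq_of_mem_sphere (D ω)) hD
  obtain ⟨μ, hμf, hμe, hμ⟩ := exists_even_measure_integral_eq (ν := ν)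
    (w := fun ω => ‖A (V ω)‖ ^ q)
    ((A.continuous.measurable.comp hVm.measurable).norm.pow_const q)
    (integrable_norm_clm_rpow hVm hpr.le hV A) (fun ω => by positivity) hDm
  have hinj : Function.Injective (LinearMap.adjoint A.toLinearMap) := by
    refine (injective_iff_map_eq_zero _).2 fun x hx => ?_
    obtain ⟨y, hy⟩ := (LinearMap.equivOfIsUnitDet (f := A.toLinearMap) hA0.isUnit).surjective x
    rw [LinearMap.equivOfIsUnitDet_apply] at hy
    rw [← inner_self_eq_zero (𝕜 := ℝ)]
    have := LinearMap.adjoint_inner_left A.toLinearMap y x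
    rw [hx, inner_zero_left, hy] at this
    exact this.symm
  -- The inverse of `T` is `S ∘ A*`, so `‖T⁻¹ x‖^q = ∫ |⟨x, A V⟩|^q = ∫ ‖A V‖^q |⟨x, D⟩|^q`: the
  -- weight that gives isotropy also gives the norm.
  set T : X ≃ₗ[ℝ] EuclideanSpace ℝ (Fin n) :=
    ((LinearEquiv.ofInjectiveEndo _ hinj).trans S).symm with hT
  refine ⟨T '' Metric.closedBall 0 1, ⟨T, rfl⟩, μ, ⟨hμf, hμe, fun x => ?_⟩, fun x => ?_⟩
  · rw [hμ _ (by fun_prop) fun θ => by simp, ← hiso x]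
  · have hTx : T.symm x = S (LinearMap.adjoint A.toLinearMap x) := by
      simp [hT]
    have hc : Continuous fun θ : USphere n =>
        |inner ℝ x (θ : EuclideanSpace ℝ (Fin n))| ^ q :=
      (by fun_prop : Continuous fun θ : USphere n =>
        |(inner ℝ x (θ : EuclideanSpace ℝ (Fin n)) : ℝ)|).rpow_const fun _ => .inr hpr.le
    have h : ‖T.symm x‖ ^ q =
        ∫ θ : USphere n, |inner ℝ x (θ : EuclideanSpace ℝ (Fin n))| ^ q ∂μ := by
      rw [hμ _ hc fun θ => by simp, hTx, hS]
      refine integral_congr_ae (.of_forall fun ω => ?_)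
      simp only
      rw [LinearMap.adjoint_inner_left, ContinuousLinearMap.coe_coe,
        ← Real.mul_rpow (norm_nonneg _) (abs_nonneg _)]
      conv_lhs => rw [hD ω]
      rw [inner_smul_right, abs_mul, abs_norm]
    rw [gauge_image_closedBall, sphereLpNorm, ← h, ← Real.rpow_mul (norm_nonneg _),
      mul_one_div_cancel hpr.ne', Real.rpow_one]

theorem mainTheorem7 :
    ∃ C : ℝ, 0 < C ∧
      ∀ (p : ENNReal) [Fact (1 ≤ p)], p ≠ ⊤ →
      ∀ {Ω : Type*} [MeasurableSpace Ω] (ν : Measure Ω)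
        (X : Submodule ℝ (Lp ℝ p ν)) (n : ℕ), 1 ≤ n → Module.finrank ℝ X = n →
        (∃ B : Set (EuclideanSpace ℝ (Fin n)), IsLewisPosition p.toReal X B) ∧
        ∀ B : Set (EuclideanSpace ℝ (Fin n)), IsLewisPosition p.toReal X B →
          MemLp (gauge B) 2 (stdGaussian (EuclideanSpace ℝ (Fin n))) ∧
          variance (gauge B) (stdGaussian (EuclideanSpace ℝ (Fin n))) ≤
            C ^ p.toReal * (n : ℝ) ^ (2 / p.toReal - 1) := by
  refine ⟨512, by norm_num, fun p _ hp Ω _ ν X n hn hX => ⟨exists_isLewisPosition hp X hn hX, ?_⟩⟩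
  rintro B ⟨-, μ, hμ, hB⟩
  have hp1 : 1 ≤ p.toReal := by
    simpa using (ENNReal.toReal_le_toReal ENNReal.one_ne_top hp).2 (Fact.out : 1 ≤ p)
  rw [show gauge B = sphereLpNorm p.toReal μ from funext hB]
  exact hμ.memLp_and_variance_sphereLpNorm_le hn hp1
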